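/- Conventions. Let $X$ and $Y$ denote metric spaces. - The Nagata dimension $\dim_N(X)\in\{0,1,2,\dots\}\cup\{\infty\}$ is the least integer $n\ge 0$ with the following property: there is $c>0$ such that for every $s>0$ the space $X$ has a cover by sets of diameter at most $cs$ such that every subset of $X$ of diameter at most $s$ meets at most $n+1$ members of the cover; $\dim_N(X)=\infty$ if there is no such $n$. - The Assouad dimension $\dim_A(Y)\in[0,\infty]$ is the infimum of all $\beta>0$ such that, for some $C>0$, for every $0<\epsilon<1$ and every set $E\subseteq Y$ of finite diameter $d$, $E$ can be covered by at most $C\epsilon^{-\beta}$ sets of diameter at most $\epsilon d$ (with $\inf\emptyset=\infty$). - A continuum is a nonempty compact connected set; it is non-trivial if it has at least two points. $X$ is bounded turning if there is $C>0$ such that any two points $x,y\in X$ lie in a continuum of diameter at most $C\,d(x,y)$. - A continuous map $f\colon X\to Y$ is a branched quasisymmetry if there is a homeomorphism $\eta\colon[0,\infty)\to[0,\infty)$ such that $$\operatorname{diam}(f(E))\le \eta\left(\frac{\operatorname{diam}(E)}{\operatorname{diam}(E')}\right)\operatorname{diam}(f(E'))$$ for all pairs of intersecting non-trivial continua $E,E'$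 in $X$. Corollary. Let $X$ be a compact, bounded turning metric space with at least two points. Then $$\dim_N(X)=\inf\{\dim_A(Y):\ Y \text{ is a metric space and there is a non-constant branched quasisymmetry of } X \text{ onto } Y\}$$ as elements of $[0,\infty]$, where $\inf\emptyset=\infty$; in particular, one of these two numbers is infinite if and only if the other is. Moreover, if $\dim_N(X)<\infty$, then the infimum is attained. -/

import Mathlib

open scoped NNReal ENNReal

universe u v

/-- `X` has a cover by sets of diameter at most `c * s` such that every subset of `X` of diameter
at most `s` meets at most `m` members of the cover. Diameters are extended (so unbounded sets have
diameter `∞`). -/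
def HasNagataCover (X : Type u) [MetricSpace X] (c s : ℝ) (m : ℕ) : Prop :=
  ∃ 𝓑 : Set (Set X), ⋃₀ 𝓑 = Set.univ ∧
    (∀ B ∈ 𝓑, Metric.ediam B ≤ ENNReal.ofReal (c * s)) ∧
    ∀ A : Set X, Metric.ediam A ≤ ENNReal.ofReal s →
      {B ∈ 𝓑 | (B ∩ A).Nonempty}.encard ≤ (m : ℕ∞)

/-- The Nagata dimension: the least `n : ℕ` for which there is `c > 0` such that, for all `s > 0`,
`X` has a `c * s`-bounded covering with `s`-multiplicity at most `n + 1`; it is `⊤` if there is no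
such `n`. -/
noncomputable def nagataDim (X : Type u) [MetricSpace X] : ℕ∞ :=
  sInf {N : ℕ∞ | ∃ n : ℕ, N = (n : ℕ∞) ∧
    ∃ c : ℝ, 0 < c ∧ ∀ s : ℝ, 0 < s → HasNagataCover X c s (n + 1)}

/-- The Assouad dimension: the infimum of the `β > 0` such that, for some `C > 0`, every
(bounded) set `E` can be covered, for every `0 < ε < 1`, by at most `C * ε ^ (-β)` sets of diameter
at most `ε * diam E`; it is `∞` if there is no such `β`. -/
noncomputable def assouadDim (Y : Type v) [MetricSpace Y] : ℝ≥0∞ :=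
  sInf {b : ℝ≥0∞ | ∃ β : ℝ, 0 < β ∧ b = ENNReal.ofReal β ∧
    ∃ C : ℝ, 0 < C ∧ ∀ E : Set Y, Metric.ediam E ≠ ⊤ → ∀ ε : ℝ, 0 < ε → ε < 1 →
      ∃ F : Finset (Set Y), (F.card : ℝ) ≤ C * ε ^ (-β) ∧
        E ⊆ ⋃ B ∈ F, B ∧ ∀ B ∈ F, Metric.ediam B ≤ ENNReal.ofReal ε * Metric.ediam E}

/-- A continuum: a (nonempty) compact connected set. -/
def IsContinuumSet {X : Type u} [MetricSpace X] (K : Set X) : Prop :=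
  IsCompact K ∧ IsConnected K

/-- Bounded turning: any two points lie in a continuum whose diameter is at most a fixed multiple of
their distance. (The reverse comparison is automatic.) -/
def IsBoundedTurning (X : Type u) [MetricSpace X] : Prop :=
  ∃ C : ℝ, 0 < C ∧ ∀ x y : X, ∃ K : Set X, IsContinuumSet K ∧ x ∈ K ∧ y ∈ K ∧
    Metric.diam K ≤ C * dist x y

/-- A branched quasisymmetry: a continuous map `f` for which there is a homeomorphism `η` of
`[0, ∞)` with `diam f(E) ≤ η (diam E / diam E') * diam f(E')` for all intersecting non-trivial
continua `E`, `E'`. -/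
def IsBranchedQuasisymmetry {X : Type u} {Y : Type v} [MetricSpace X] [MetricSpace Y]
    (f : X → Y) : Prop :=
  Continuous f ∧ ∃ η : ℝ≥0 ≃ₜ ℝ≥0, ∀ E E' : Set X,
    IsContinuumSet E → E.Nontrivial → IsContinuumSet E' → E'.Nontrivial → (E ∩ E').Nonempty →
      Metric.diam (f '' E) ≤
        (η (Real.toNNReal (Metric.diam E / Metric.diam E')) : ℝ) * Metric.diam (f '' E')

/-- The set of all `dim_A(Y)`, where `Y` is a metric space (in an arbitrary universe) such that there
is a non-constant branched quasisymmetry of `X` onto `Y`. -/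
def branchedImageAssouadDims (X : Type u) [MetricSpace X] : Set ℝ≥0∞ :=
  {a : ℝ≥0∞ | ∃ (Y : Type v) (_ : MetricSpace Y) (f : X → Y),
    IsBranchedQuasisymmetry f ∧ Function.Surjective f ∧ (∃ x x' : X, f x ≠ f x') ∧
      a = assouadDim Y}

/-!
Both inequalities go through colourings. A space has Nagata dimension at most `n` if and only if, at
every scale `s`, its points can be coloured with `n + 1` colours such that chains of points of one
colour with steps of length at most `s` have diameter at most a fixed multiple of `s`
(`HasChainColoring`). Such colourings come from real functions of which only few are small at each
point (`exists_gap_coloring`): the colour of a point is the number of a gap in their list of values.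

*Nagata dimension at most Assouad dimension of the image.* Let `f : X → Y` be a non-constant branched
quasisymmetry onto a space with covering exponent `β < n + 1`. A greedy choice of radii
(`exists_positions`, `AssouadBound.exists_radii`) yields balls in `Y` that cover at all dyadic scales
such that at most `n` thin spheres of comparable radii meet in a point, since each sphere lowers the
covering exponent by one. At scale `s`, each point `x` of `X` has an image scale `r x`, the diameter
of the image of a continuum through `x` of size about `s`, and it varies by bounded factors only
(`IsBranchedQuasisymmetry.exists_image_scale`). The distances of `f x` to the spheres of radius about
`r x` define a colouring of `X`. A chain of one colour that begins deep inside a ball of the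
appropriate scale cannot cross its sphere, so that it lies in a continuum mapped into this ball, and
the distortion inequality bounds its diameter (`IsBranchedQuasisymmetry.exists_chainColoring`).

*The infimum is attained.* If `X` has Nagata dimension `n`, the distances to the `n + 1` colour
classes, taken modulo the diagonal, map `X` to `ℝⁿ` and detect connected sets which are large compared
to the scale (`exists_single_scale_map`). A sum of these maps over very sparse scales, with
geometrically decaying coefficients, gives `f : X → ℝⁿ` for which the diameter of `f '' E` is
comparable to a power of the diameter of `E` for all continua `E` (`exists_multi_scale_map`,
`exists_holder_map`). This is a branched quasisymmetry onto a subset of `ℝⁿ`, whose Assouad dimension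
is at most `n`, hence equal to `n` by the first part.
-/

/-! ### Coloured decompositions -/

/-- `X` splits into `n + 1` colour classes in such a way that a chain of points of one colour with
steps of length at most `s` has its endpoints at distance at most `c * s`. -/
def HasChainColoring (X : Type u) [MetricSpace X] (c s : ℝ) (n : ℕ) : Prop :=
  ∃ col : X → Fin (n + 1), ∀ x y : X,
    Relation.ReflTransGen (fun a b => col a = col b ∧ dist a b ≤ s) x y → dist x y ≤ c * s

/-- The colour `k` of `x` is chosen such that the `k`-th of the `n + 1` intervals that divide `(0, K)`
contains none of the values `a i x`; such `k` exists since at most `n` values lie in `(0, K)`. -/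
lemma exists_gap_coloring {X I : Type*} (a : I → X → ℝ) {K : ℝ} (hK : 0 < K) (n : ℕ)
    (h : ∀ x, {i | 0 < a i x ∧ a i x < K}.encard ≤ n) :
    ∃ col : X → Fin (n + 1), ∀ x i, a i x ≤ (col x : ℕ) * (K / (n + 1)) ∨
      ((col x : ℕ) + 1) * (K / (n + 1)) ≤ a i x := by
  have hd : 0 < K / (n + 1) := by positivity
  suffices H : ∀ x, ∃ k : Fin (n + 1), ∀ i, a i x ≤ (k : ℕ) * (K / (n + 1)) ∨
      ((k : ℕ) + 1) * (K / (n + 1)) ≤ a i x by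
    choose col hcol using H
    exact ⟨col, hcol⟩
  intro x
  by_contra! hcon
  choose g hg1 hg2 using hcon
  have hginj : Function.Injective g := by
    intro k k' hkk
    have h1 := hg1 k
    have h2 := hg2 k
    have h3 := hg1 k'
    have h4 := hg2 k'
    rw [← hkk] at h3 h4
    have h5 : ((k : ℕ) : ℝ) < (k' : ℕ) + 1 := lt_of_mul_lt_mul_right (h1.trans h4) hd.le
    have h6 : ((k' : ℕ) : ℝ) < (k : ℕ) + 1 := lt_of_mul_lt_mul_right (h3.trans h2) hd.le
    have h7 : (k : ℕ) < k' + 1 := by exact_mod_cast h5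
    have h8 : (k' : ℕ) < k + 1 := by exact_mod_cast h6
    ext; omega
  have hsub : Set.range g ⊆ {i | 0 < a i x ∧ a i x < K} := by
    rintro _ ⟨k, rfl⟩
    refine ⟨lt_of_le_of_lt (by positivity) (hg1 k), lt_of_lt_of_le (hg2 k) ?_⟩
    have : ((k : ℕ) : ℝ) + 1 ≤ n + 1 := by exact_mod_cast k.2
    calc ((k : ℕ) + 1 : ℝ) * (K / (n + 1)) ≤ (n + 1) * (K / (n + 1)) := by gcongr
      _ = K := by field_simp
  have h9 := (Set.encard_le_encard hsub).trans (h x)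
  rw [← Set.image_univ, hginj.encard_image, Set.encard_univ] at h9
  simp at h9
  have : n + 1 ≤ n := by exact_mod_cast h9
  omega

/-- The set of `i` with `a i` below the gap is constant along chains of one colour, as `a i` cannot jump
over the gap in a step in which it varies by less than the length of the gap. -/
lemma mem_of_gap {X I : Type*} {a : I → X → ℝ} {d : ℝ} {n : ℕ} {col : X → Fin (n + 1)}
    (hcol : ∀ x i, a i x ≤ (col x : ℕ) * d ∨ ((col x : ℕ) + 1) * d ≤ a i x)
    {x y : X} {i : I} (hc : col x = col y) (hxy : a i y < a i x + d)
    (hx : a i x ≤ (col x : ℕ) * d) : a i y ≤ (col y : ℕ) * d := by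
  rcases hcol y i with h | h
  · exact h
  · rw [← hc] at h; linarith

/-- The colouring is defined by the distances to the members of a cover at a slightly larger scale. At
most `n + 1` of them are small at a given point and one of these vanishes; the members below the gap
remain the same along a chain of one colour. -/
lemma hasChainColoring_of_nagataCover {X : Type u} [MetricSpace X] {c : ℝ} {n : ℕ} (hc : 0 < c)
    (h : ∀ s : ℝ, 0 < s → HasNagataCover X c s (n + 1)) :
    ∀ s : ℝ, 0 < s → HasChainColoring X (2 * (n + 2) * (1 + c)) s n := by
  intro s hs
  -- The gaps of length `K / (n + 1)` have to be longer than the steps of a chain.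
  set K : ℝ := (n + 2) * s with hKdef
  have hK : 0 < K := by positivity
  obtain ⟨B, hB1, hB2, hB3⟩ := h (2 * K) (by positivity)
  -- The empty set may belong to the cover; its `infDist` is `0` by convention.
  let I := {b : Set X // b ∈ B ∧ b.Nonempty}
  let a : I → X → ℝ := fun i x => Metric.infDist x i.1
  have hself : ∀ x, ∃ i : I, x ∈ i.1 := by
    intro x
    obtain ⟨b, hb, hx⟩ : x ∈ ⋃₀ B := hB1 ▸ Set.mem_univ x
    exact ⟨⟨b, hb, x, hx⟩, hx⟩
  have hcount : ∀ x, {i : I | 0 < a i x ∧ a i x < K}.encard ≤ n := by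
    intro x
    obtain ⟨i₀, hi₀⟩ := hself x
    have h1 := hB3 (Metric.ball x K) (by
      refine Metric.ediam_le fun y hy z hz => ?_
      rw [edist_dist]
      refine ENNReal.ofReal_le_ofReal ?_
      have := dist_triangle_right y z x
      rw [Metric.mem_ball] at hy hz
      linarith)
    have h2 : Set.image (Subtype.val : I → Set X) (insert i₀ {i : I | 0 < a i x ∧ a i x < K}) ⊆
        {b ∈ B | (b ∩ Metric.ball x K).Nonempty} := by
      rintro _ ⟨i, hi, rfl⟩
      rcases hi with rfl | hi
      · exact ⟨i.2.1, x, hi₀, Metric.mem_ball_self hK⟩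
      · obtain ⟨y, hy, hxy⟩ := (Metric.infDist_lt_iff i.2.2).1 hi.2
        exact ⟨i.2.1, y, hy, by rwa [Metric.mem_ball, dist_comm]⟩
    have h3 := (Set.encard_le_encard h2).trans h1
    rw [Subtype.val_injective.encard_image, Set.encard_insert_of_notMem] at h3
    · push_cast at h3
      exact (ENat.add_le_add_iff_right (by simp)).1 h3
    · intro hmem
      have := hmem.1
      simp only [a, Metric.infDist_zero_of_mem hi₀] at this
      exact lt_irrefl _ this
  obtain ⟨col, hcol⟩ := exists_gap_coloring a hK n hcount
  have hd : s < K / (n + 1) := by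
    rw [lt_div_iff₀ (by positivity), hKdef]; nlinarith
  refine ⟨col, fun x y hxy => ?_⟩
  obtain ⟨i₀, hi₀⟩ := hself x
  have key : a i₀ y ≤ (col y : ℕ) * (K / (n + 1)) := by
    induction hxy with
    | refl =>
      simp only [a, Metric.infDist_zero_of_mem hi₀]; positivity
    | @tail y z _ hstep ih =>
      refine mem_of_gap hcol hstep.1 ?_ ih
      have h1 : Metric.infDist z i₀.1 ≤ Metric.infDist y i₀.1 + dist z y :=
        Metric.infDist_le_infDist_add_dist
      have h2 := hstep.2
      rw [dist_comm] at h2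
      simp only [a]
      linarith
  have hlt : Metric.infDist y i₀.1 < K := by
    refine lt_of_le_of_lt key ?_
    have h1 : ((col y : ℕ) : ℝ) < n + 1 := by exact_mod_cast (col y).2
    calc ((col y : ℕ) : ℝ) * (K / (n + 1)) < (n + 1) * (K / (n + 1)) := by gcongr
      _ = K := by field_simp
  obtain ⟨z, hz, hyz⟩ := (Metric.infDist_lt_iff i₀.2.2).1 hlt
  have h1 := (Metric.edist_le_ediam_of_mem hi₀ hz).trans (hB2 _ i₀.2.1)
  rw [edist_dist, ENNReal.ofReal_le_ofReal_iff (by positivity)] at h1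
  have h2 := dist_triangle_right x y z
  have h3 : 0 < (n + 2) * s := by positivity
  rw [hKdef] at hyz h1
  nlinarith

/-- The classes of points joined by chains of one colour form the cover: a set of diameter at most `s`
meets at most one class of each colour. -/
lemma nagataCover_of_hasChainColoring {X : Type u} [MetricSpace X] {c s : ℝ} {n : ℕ}
    (h : HasChainColoring X c s n) : HasNagataCover X c s (n + 1) := by
  obtain ⟨col, hcol⟩ := h
  set r : X → X → Prop := fun a b => col a = col b ∧ dist a b ≤ s with hr
  have hsymm : ∀ {a b}, Relation.ReflTransGen r a b → Relation.ReflTransGen r b a := by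
    intro a b hab
    induction hab with
    | refl => exact .refl
    | tail _ h ih => exact .head ⟨h.1.symm, (dist_comm _ _).trans_le h.2⟩ ih
  have hcoleq : ∀ {a b}, Relation.ReflTransGen r a b → col a = col b := by
    intro a b hab
    induction hab with
    | refl => rfl
    | tail _ h ih => exact ih.trans h.1
  refine ⟨Set.range fun x => {y | Relation.ReflTransGen r x y}, ?_, ?_, ?_⟩
  · exact Set.eq_univ_of_forall fun x => ⟨_, ⟨x, rfl⟩, Relation.ReflTransGen.refl⟩
  · rintro _ ⟨x, rfl⟩
    refine Metric.ediam_le fun y hy z hz => ?_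
    rw [edist_dist]
    exact ENNReal.ofReal_le_ofReal (hcol _ _ ((hsymm hy).trans hz))
  · intro A hA
    rcases Set.eq_empty_or_nonempty
      {B ∈ Set.range fun x => {y | Relation.ReflTransGen r x y} | (B ∩ A).Nonempty} with h0 | ⟨B₀, hB₀⟩
    · rw [h0]; simp
    have : Nonempty X := ⟨hB₀.2.some⟩
    have hsnn : 0 ≤ s ∨ s < 0 := le_or_gt 0 s
    have hcls : ∀ B ∈ {B ∈ Set.range fun x => {y | Relation.ReflTransGen r x y} |
        (B ∩ A).Nonempty}, ∃ b ∈ A, B = {y | Relation.ReflTransGen r b y} := by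
      rintro _ ⟨⟨x, rfl⟩, b, hb, hbA⟩
      exact ⟨b, hbA, Set.ext fun y => ⟨fun hy => (hsymm hb).trans hy, fun hy => hb.trans hy⟩⟩
    choose! g hgA hg using hcls
    have hinj : Set.InjOn (fun B => col (g B)) {B ∈ Set.range fun x =>
        {y | Relation.ReflTransGen r x y} | (B ∩ A).Nonempty} := by
      intro B hB B' hB' hcc
      have hstep : Relation.ReflTransGen r (g B) (g B') := by
        have h1 := (Metric.edist_le_ediam_of_mem (hgA B hB) (hgA B' hB')).trans hA
        rcases hsnn with hs | hs
        · rw [edist_dist, ENNReal.ofReal_le_ofReal_iff hs] at h1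
          exact .single ⟨hcc, h1⟩
        · rw [ENNReal.ofReal_of_nonpos hs.le, nonpos_iff_eq_zero, edist_eq_zero] at h1
          rw [h1]
      rw [hg B hB, hg B' hB']
      exact Set.ext fun y => ⟨fun hy => (hsymm hstep).trans hy, fun hy => hstep.trans hy⟩
    rw [← hinj.encard_image]
    refine (Set.encard_le_encard (Set.subset_univ _)).trans ?_
    rw [Set.encard_univ]
    simp

/-! ### Maps to Euclidean space detecting the size of connected sets -/

/-- The distance to the set of points of colour `i`, truncated and normalised at scale `s`; it is
constant `1` if the colour does not occur. -/
noncomputable def colorDist {X : Type u} [MetricSpace X] {n : ℕ} (col : X → Fin (n + 1)) (s : ℝ)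
    (i : Fin (n + 1)) (x : X) : ℝ :=
  open Classical in
  if (col ⁻¹' {i}).Nonempty then min 1 (Metric.infDist x (col ⁻¹' {i}) / s) else 1

section colorDist

variable {X : Type u} [MetricSpace X] {n : ℕ} {col : X → Fin (n + 1)} {s : ℝ}

lemma colorDist_nonneg (hs : 0 < s) (i : Fin (n + 1)) (x : X) : 0 ≤ colorDist col s i x := by
  unfold colorDist
  split_ifs
  · exact le_min zero_le_one (div_nonneg Metric.infDist_nonneg hs.le)
  · exact zero_le_one

lemma colorDist_le_one (i : Fin (n + 1)) (x : X) : colorDist col s i x ≤ 1 := by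
  unfold colorDist
  split_ifs
  · exact min_le_left _ _
  · exact le_rfl

lemma colorDist_self (x : X) : colorDist col s (col x) x = 0 := by
  have hx : x ∈ col ⁻¹' {col x} := rfl
  rw [colorDist, if_pos ⟨x, hx⟩, Metric.infDist_zero_of_mem hx]
  simp

lemma exists_of_colorDist_lt_one (hs : 0 < s) {i : Fin (n + 1)} {x : X}
    (h : colorDist col s i x < 1) : ∃ b, col b = i ∧ dist x b < s := by
  unfold colorDist at h
  split_ifs at h with hne
  · have h1 : Metric.infDist x (col ⁻¹' {i}) < s := by
      rcases min_lt_iff.1 h with h | h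
      · exact absurd h (lt_irrefl _)
      · rwa [div_lt_one hs] at h
    obtain ⟨b, hb, hxb⟩ := (Metric.infDist_lt_iff hne).1 h1
    exact ⟨b, hb, hxb⟩
  · exact absurd h (lt_irrefl _)

lemma abs_colorDist_sub_le (hs : 0 < s) (i : Fin (n + 1)) (x y : X) :
    |colorDist col s i x - colorDist col s i y| ≤ 1 / s * dist x y := by
  unfold colorDist
  split_ifs with hne
  · refine (abs_min_sub_min_le_max _ _ _ _).trans ?_
    rw [sub_self, abs_zero, max_eq_right (abs_nonneg _), ← sub_div, abs_div, abs_of_pos hs,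
      div_mul_eq_mul_div, one_mul]
    gcongr
    have := (Metric.lipschitz_infDist_pt (col ⁻¹' {i})).dist_le_mul x y
    simpa [Real.dist_eq] using this
  · simp only [sub_self, abs_zero]; positivity

end colorDist

/-- A map to `ℝⁿ` at one scale: if it varies little along a connected set, near some point, then this
set is small. The `n + 1` distance functions to the colour classes are used modulo the diagonal;
since one of them vanishes at every point, nothing is lost. -/
lemma exists_single_scale_map {X : Type u} [MetricSpace X] {c s : ℝ} {n : ℕ} (hs : 0 < s)
    (h : HasChainColoring X c (3 * s) n) :
    ∃ v : X → Fin n → ℝ, (∀ x, ‖v x‖ ≤ 1) ∧ (∀ x y, dist (v x) (v y) ≤ 2 / s * dist x y) ∧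
      ∀ E : Set X, IsPreconnected E → ∀ x ∈ E,
        (∀ z ∈ E, dist x z ≤ (3 * c + 2) * s → dist (v x) (v z) < 1 / 2) →
          ∀ z ∈ E, dist x z ≤ (3 * c + 2) * s := by
  obtain ⟨col, hcol⟩ := h
  set U := colorDist col s with hU
  refine ⟨fun x i => U i.succ x - U 0 x, fun x => ?_, fun x y => ?_, fun E hE x hx hosc => ?_⟩
  · refine (pi_norm_le_iff_of_nonneg zero_le_one).2 fun i => ?_
    rw [Real.norm_eq_abs, abs_le]
    have h1 := colorDist_nonneg (col := col) hs i.succ x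
    have h2 := colorDist_nonneg (col := col) hs 0 x
    have h3 := colorDist_le_one (col := col) (s := s) i.succ x
    have h4 := colorDist_le_one (col := col) (s := s) 0 x
    constructor <;> linarith
  · refine (dist_pi_le_iff (by positivity)).2 fun i => ?_
    rw [Real.dist_eq]
    have h1 := abs_le.1 (abs_colorDist_sub_le (col := col) hs i.succ x y)
    have h2 := abs_le.1 (abs_colorDist_sub_le (col := col) hs 0 x y)
    have h3 : 2 / s * dist x y = 1 / s * dist x y + 1 / s * dist x y := by ring
    rw [abs_le, h3]
    constructor <;> linarith
  · have near : ∀ z ∈ E, dist x z ≤ (3 * c + 2) * s → ∃ b, col b = col x ∧ dist z b < s := by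
      intro z hz hxz
      refine exists_of_colorDist_lt_one hs ?_
      have hv := hosc z hz hxz
      -- Only the differences `U j - U 0` are controlled. Since `U (col x)` vanishes at `x` and
      -- `U (col z)` at `z`, this bounds `U 0 z - U 0 x` from above and then `U (col x) z`.
      have hall : ∀ j, |(U j x - U j z) - (U 0 x - U 0 z)| < 1 / 2 := by
        intro j
        refine Fin.cases ?_ (fun j => ?_) j
        · simp
        · have := (dist_le_pi_dist _ _ j).trans_lt hv
          rw [Real.dist_eq] at this
          rwa [show U j.succ x - U j.succ z - (U 0 x - U 0 z)
            = U j.succ x - U 0 x - (U j.succ z - U 0 z) by ring]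
      have h1 := abs_lt.1 (hall (col x))
      have h2 := abs_lt.1 (hall (col z))
      have h3 : U (col x) x = 0 := colorDist_self x
      have h4 : U (col z) z = 0 := colorDist_self z
      have h5 := colorDist_nonneg (col := col) hs (col z) x
      rw [← hU] at h5 ⊢
      linarith
    set r : X → X → Prop := fun a b => col a = col b ∧ dist a b ≤ 3 * s with hr
    set Q : Set X := {y | Relation.ReflTransGen r x y} with hQ
    have hxQ : x ∈ Q := Relation.ReflTransGen.refl
    have hQcol : ∀ b ∈ Q, col b = col x := by
      intro b hb
      induction hb with
      | refl => rfl
      | tail _ h ih => exact h.1.symm.trans ih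
    -- No point of `E` has distance exactly `s` from `Q`, so the connected set `E` stays near `Q`.
    have hsub : E ⊆ {z | Metric.infDist z Q < s} := by
      refine hE.subset_left_of_subset_union (v := {z | s < Metric.infDist z Q})
        (isOpen_lt (Metric.continuous_infDist_pt Q) continuous_const)
        (isOpen_lt continuous_const (Metric.continuous_infDist_pt Q)) ?_ ?_ ⟨x, hx, ?_⟩
      · exact Set.disjoint_left.2 fun z h1 h2 =>
          lt_asymm (show Metric.infDist z Q < s from h1) h2
      · intro z hz
        by_contra hcon
        simp only [Set.mem_union, Set.mem_ofPred_eq, not_or, not_lt] at hcon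
        obtain ⟨b, hb, hzb⟩ := (Metric.infDist_lt_iff ⟨x, hxQ⟩).1
          (show Metric.infDist z Q < 2 * s by linarith [hcon.2])
        have h1 := hcol x b hb
        have h2 := dist_triangle_right x z b
        obtain ⟨b', hb', hzb'⟩ := near z hz (by linarith)
        have hbb : r b b' := ⟨(hQcol b hb).trans hb'.symm, by
          have := dist_triangle_left b b' z
          linarith⟩
        have h3 := Metric.infDist_le_dist_of_mem (x := z)
          (show b' ∈ Q from Relation.ReflTransGen.tail hb hbb)
        linarith [hcon.1]
      · simp only [Set.mem_ofPred_eq, Metric.infDist_zero_of_mem hxQ]; exact hs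
    intro z hz
    obtain ⟨b, hb, hzb⟩ := (Metric.infDist_lt_iff ⟨x, hxQ⟩).1 (hsub hz)
    have h1 := hcol x b hb
    have h2 := dist_triangle_right x z b
    linarith

/-- A series with geometrically small terms away from the index `k` is close to its `k`-th term. -/
lemma norm_tsum_sub_term_le {V : Type*} [NormedAddCommGroup V] [CompleteSpace V] {w : ℕ → V}
    {a q B : ℝ} {k : ℕ} (ha0 : 0 ≤ a) (ha : a < 1) (hq0 : 0 ≤ q) (hq : q < 1) (hB : 0 ≤ B)
    (h1 : ∀ j, ‖w j‖ ≤ 2 * a ^ j) (h2 : ∀ j < k, ‖w j‖ ≤ B * q ^ (k - j)) :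
    ‖(∑' j, w j) - w k‖ ≤ B * (q / (1 - q)) + 2 * a ^ (k + 1) / (1 - a) := by
  have hsum : Summable fun j => 2 * a ^ j := (summable_geometric_of_lt_one ha0 ha).mul_left 2
  have hw : Summable w := Summable.of_norm_bounded hsum h1
  have hhead : ∀ m : ℕ, ∑ j ∈ Finset.range m, q ^ (m - j) ≤ q / (1 - q) := by
    intro m
    induction m with
    | zero => simpa using div_nonneg hq0 (by linarith)
    | succ m ih =>
      rw [Finset.sum_range_succ]
      have : ∑ j ∈ Finset.range m, q ^ (m + 1 - j) = q * ∑ j ∈ Finset.range m, q ^ (m - j) := by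
        rw [Finset.mul_sum]
        refine Finset.sum_congr rfl fun j hj => ?_
        rw [Finset.mem_range] at hj
        rw [Nat.sub_add_comm hj.le, pow_succ, mul_comm]
      rw [this, Nat.add_sub_cancel_left, pow_one]
      have h3 : q * (q / (1 - q)) + q = q / (1 - q) := by
        have : 1 - q ≠ 0 := by linarith
        field_simp; ring
      nlinarith
  have hsplit : (∑' j, w j) - w k = ∑ j ∈ Finset.range k, w j + ∑' j, w (j + (k + 1)) := by
    rw [← hw.sum_add_tsum_nat_add (k + 1), Finset.sum_range_succ]; abel
  have htail : ‖∑' j, w (j + (k + 1))‖ ≤ 2 * a ^ (k + 1) / (1 - a) := by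
    refine tsum_of_norm_bounded (g := fun j => 2 * a ^ (k + 1) * a ^ j) ?_ fun j => ?_
    · have := (hasSum_geometric_of_lt_one ha0 ha).mul_left (2 * a ^ (k + 1))
      rwa [← div_eq_mul_inv] at this
    · refine (h1 _).trans (le_of_eq ?_)
      rw [pow_add]; ring
  rw [hsplit]
  refine (norm_add_le _ _).trans (add_le_add ?_ htail)
  calc ‖∑ j ∈ Finset.range k, w j‖ ≤ ∑ j ∈ Finset.range k, B * q ^ (k - j) :=
        norm_sum_le_of_le _ fun j hj => h2 j (Finset.mem_range.1 hj)
    _ = B * ∑ j ∈ Finset.range k, q ^ (k - j) := by rw [Finset.mul_sum]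
    _ ≤ _ := by gcongr; exact hhead k

/-- A lacunary sum of the single scale maps: the diameter of the image of a connected set is
determined, up to bounded factors, by the diameter of the set. -/
lemma exists_multi_scale_map {X : Type u} [MetricSpace X] {c : ℝ} {n : ℕ} (hc0 : 0 < c)
    (hc : ∀ s : ℝ, 0 < s → HasChainColoring X c s n) {Δ : ℝ} (hΔ : 0 < Δ) :
    ∃ R L : ℝ, 0 < R ∧ R < L ∧ 1 < L ∧ ∃ f : X → Fin n → ℝ, Continuous f ∧
      (∀ x y, ∀ k : ℕ, dist x y ≤ Δ * L⁻¹ ^ k → dist (f x) (f y) ≤ 3 * (1 / 12 : ℝ) ^ k) ∧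
      ∀ E : Set X, IsPreconnected E → ∀ k : ℕ,
        (∀ x ∈ E, ∀ y ∈ E, dist (f x) (f y) < (1 / 12 : ℝ) ^ k / 12) →
          ∀ x ∈ E, ∀ y ∈ E, dist x y ≤ R * (Δ * L⁻¹ ^ k) := by
  set R : ℝ := 3 * c + 2 with hR
  have hR1 : 1 < R := by linarith
  -- The ratio `L` of consecutive scales is so large that, on sets of size `R` at scale `k`, the
  -- coarser terms vary by at most `1 / 5` of the `k`-th coefficient; the finer ones by `2 / 11`.
  set L : ℝ := 12 * (10 * R + 1) with hL
  have hL0 : 0 < L := by positivity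
  have hsc : ∀ k : ℕ, 0 < Δ * L⁻¹ ^ k := fun k => by positivity
  choose v hv1 hv2 hv3 using fun k : ℕ =>
    exists_single_scale_map (hsc k) (hc (3 * (Δ * L⁻¹ ^ k)) (by linarith [hsc k]))
  set a : ℝ := 1 / 12 with ha
  have ha0 : 0 < a := by norm_num
  have hnorm : ∀ k x, ‖a ^ k • v k x‖ ≤ a ^ k := by
    intro k x
    rw [norm_smul, Real.norm_of_nonneg (by positivity)]
    exact mul_le_of_le_one_right (by positivity) (hv1 k x)
  have hsum : Summable fun k : ℕ => a ^ k := summable_geometric_of_lt_one ha0.le (by norm_num)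
  have hsumv : ∀ x, Summable fun k => a ^ k • v k x := fun x =>
    Summable.of_norm_bounded hsum fun k => hnorm k x
  have hdiff : ∀ x y k, ‖a ^ k • (v k x - v k y)‖ = a ^ k * dist (v k x) (v k y) := by
    intro x y k
    rw [norm_smul, Real.norm_of_nonneg (by positivity), dist_eq_norm]
  have key : ∀ x y, ∀ k : ℕ, dist x y ≤ R * (Δ * L⁻¹ ^ k) →
      ‖((∑' j, a ^ j • v j x) - ∑' j, a ^ j • v j y) - a ^ k • (v k x - v k y)‖
        ≤ a ^ k * (1 / 5 + 2 / 11) := by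
    intro x y k hxy
    rw [← (hsumv x).tsum_sub (hsumv y)]
    simp_rw [← smul_sub]
    refine (norm_tsum_sub_term_le (w := fun j => a ^ j • (v j x - v j y)) (a := a)
      (q := (10 * R + 1)⁻¹) (B := 2 * R * a ^ k) ha0.le (by norm_num) (by positivity)
      (inv_lt_one_of_one_lt₀ (by linarith)) (by positivity) (fun j => ?_) (fun j hj => ?_)).trans ?_
    · rw [hdiff, mul_comm]
      gcongr
      rw [dist_eq_norm]
      refine (norm_sub_le _ _).trans ?_
      linarith [hv1 j x, hv1 j y]
    · rw [hdiff]
      calc a ^ j * dist (v j x) (v j y) ≤ a ^ j * (2 / (Δ * L⁻¹ ^ j) * (R * (Δ * L⁻¹ ^ k))) := by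
            gcongr
            exact (hv2 j x y).trans (by have := hsc j; gcongr)
        _ = 2 * R * a ^ k * (10 * R + 1)⁻¹ ^ (k - j) := by
            obtain ⟨m, rfl⟩ := Nat.exists_eq_add_of_lt hj
            have e1 : j + m + 1 - j = m + 1 := by omega
            have e2 : L⁻¹ = a * (10 * R + 1)⁻¹ := by rw [hL, ha, mul_inv]; norm_num
            have e3 : L⁻¹ ^ (j + m + 1) = L⁻¹ ^ j * L⁻¹ ^ (m + 1) := by rw [← pow_add]; congr 1
            have e4 : a ^ (j + m + 1) = a ^ j * a ^ (m + 1) := by rw [← pow_add]; congr 1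
            rw [e1, e3, e4]
            have e5 : L⁻¹ ^ (m + 1) = a ^ (m + 1) * (10 * R + 1)⁻¹ ^ (m + 1) := by
              rw [e2, mul_pow]
            rw [e5]
            have : L⁻¹ ^ j ≠ 0 := by positivity
            field_simp
    · have e1 : (10 * R + 1)⁻¹ / (1 - (10 * R + 1)⁻¹) = 1 / (10 * R) := by
        have : (10 * R + 1) ≠ 0 := by positivity
        have h2 : R ≠ 0 := by positivity
        rw [div_eq_div_iff]
        · field_simp; ring
        · rw [sub_ne_zero]; intro h
          have := inv_lt_one_of_one_lt₀ (show 1 < 10 * R + 1 by linarith)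
          linarith
        · positivity
      rw [e1, pow_succ, ha]
      have h2 : R ≠ 0 := by positivity
      apply le_of_eq
      field_simp
      ring
  refine ⟨R, L, by linarith, by linarith, by linarith, fun x => ∑' j, a ^ j • v j x, ?_, ?_, ?_⟩
  · refine continuous_tsum (u := fun k => a ^ k) (fun k => ?_) hsum hnorm
    have h0 : 0 ≤ 2 / (Δ * L⁻¹ ^ k) := by have := hsc k; positivity
    have hv : Continuous (v k) := (LipschitzWith.of_dist_le_mul (K := ⟨_, h0⟩) (hv2 k)).continuous
    exact hv.const_smul (a ^ k)
  · intro x y k hxy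
    have h1 := key x y k (hxy.trans (le_mul_of_one_le_left (hsc k).le hR1.le))
    have h2 : ‖a ^ k • (v k x - v k y)‖ ≤ 2 * a ^ k := by
      rw [hdiff, mul_comm]
      gcongr
      rw [dist_eq_norm]
      refine (norm_sub_le _ _).trans ?_
      linarith [hv1 k x, hv1 k y]
    rw [dist_eq_norm]
    have h3 := norm_le_norm_sub_add ((∑' j, a ^ j • v j x) - ∑' j, a ^ j • v j y)
      (a ^ k • (v k x - v k y))
    have : 0 < a ^ k := by positivity
    nlinarith
  · intro E hE k hosc x hx y hy
    refine hv3 k E hE x hx (fun z hz hxz => ?_) y hy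
    have h1 := key x z k hxz
    have h2 := hosc x hx z hz
    rw [dist_eq_norm] at h2
    have h3 := norm_le_norm_sub_add (a ^ k • (v k x - v k z))
      ((∑' j, a ^ j • v j x) - ∑' j, a ^ j • v j z)
    rw [norm_sub_rev] at h1
    rw [hdiff] at h3
    have : 0 < a ^ k := by positivity
    have h4 : a ^ k * dist (v k x) (v k z) < a ^ k * (1 / 2) := by linarith
    exact lt_of_mul_lt_mul_left h4 this.le

lemma diam_pos_of_nontrivial {X : Type u} [MetricSpace X] {E : Set X} (hE : IsCompact E)
    (hn : E.Nontrivial) : 0 < Metric.diam E := by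
  obtain ⟨x, hx, y, hy, hxy⟩ := hn
  exact (dist_pos.2 hxy).trans_le (Metric.dist_le_diam_of_mem hE.isBounded hx hy)

/-- The map of `exists_multi_scale_map` is Hölder, with a matching lower bound on the diameters of
images of continua. -/
lemma exists_holder_map {X : Type u} [MetricSpace X] [CompactSpace X] [Nontrivial X] {c : ℝ}
    {n : ℕ} (hc0 : 0 < c) (hc : ∀ s : ℝ, 0 < s → HasChainColoring X c s n) :
    ∃ f : X → Fin n → ℝ, Continuous f ∧ ∃ α A a : ℝ, 0 < α ∧ 0 < A ∧ 0 < a ∧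
      ∀ E : Set X, IsContinuumSet E → E.Nontrivial →
        a * Metric.diam E ^ α ≤ Metric.diam (f '' E) ∧
          Metric.diam (f '' E) ≤ A * Metric.diam E ^ α := by
  set Δ := Metric.diam (Set.univ : Set X) with hΔdef
  have hΔ : 0 < Δ := diam_pos_of_nontrivial isCompact_univ Set.nontrivial_univ
  obtain ⟨R, L, hR, hRL, hL, f, hf, hup, hlow⟩ := exists_multi_scale_map hc0 hc hΔ
  have hL0 : 0 < L := by linarith
  have hLi : 0 < L⁻¹ := by positivity
  have hLi1 : L⁻¹ < 1 := inv_lt_one_of_one_lt₀ hL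
  -- The exponent turns the ratio `L` of the scales into the ratio `12` of the coefficients.
  set α := Real.logb L 12 with hα
  have hα0 : 0 < α := Real.logb_pos hL (by norm_num)
  have hLα : ∀ k : ℕ, (L⁻¹ ^ k) ^ α = (1 / 12 : ℝ) ^ k := by
    intro k
    rw [← Real.rpow_pow_comm hLi.le, Real.inv_rpow hL0.le, hα, Real.rpow_logb hL0 hL.ne'
      (by norm_num)]
    norm_num
  refine ⟨f, hf, α, 36 / Δ ^ α, 1 / (1728 * Δ ^ α), hα0, by positivity, by positivity,
    fun E hE hEn => ?_⟩
  have hD : 0 < Metric.diam E := diam_pos_of_nontrivial hE.1 hEn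
  have hDΔ : Metric.diam E ≤ Δ :=
    Metric.diam_mono (Set.subset_univ _) isCompact_univ.isBounded
  obtain ⟨k, hk1, hk2⟩ := exists_nat_pow_near_of_lt_one (div_pos hD hΔ) ((div_le_one hΔ).2 hDΔ)
    hLi hLi1
  have hfE : Bornology.IsBounded (f '' E) := (hE.1.image hf).isBounded
  have hpos : (0 : ℝ) < (1 / 12) ^ k := by positivity
  have hdiv : (Metric.diam E / Δ) ^ α = Metric.diam E ^ α / Δ ^ α :=
    Real.div_rpow hD.le hΔ.le α
  constructor
  · have h1 : (Metric.diam E / Δ) ^ α ≤ (1 / 12 : ℝ) ^ k := by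
      rw [← hLα]; gcongr
    have h2 : (1 / 12 : ℝ) ^ (k + 2) / 12 ≤ Metric.diam (f '' E) := by
      by_contra! hcon
      have h3 := hlow E hE.2.isPreconnected (k + 2) fun x hx y hy =>
        (Metric.dist_le_diam_of_mem hfE (Set.mem_image_of_mem f hx)
          (Set.mem_image_of_mem f hy)).trans_lt hcon
      have h4 := Metric.diam_le_of_forall_dist_le (by positivity) h3
      rw [lt_div_iff₀ hΔ] at hk1
      have h5 : R * (Δ * L⁻¹ ^ (k + 2)) ≤ L⁻¹ ^ (k + 1) * Δ := by
        have h6 : R * L⁻¹ ≤ 1 := by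
          rw [← div_eq_mul_inv, div_le_one hL0]; exact hRL.le
        have h7 : 0 < L⁻¹ ^ (k + 1) * Δ := by positivity
        calc R * (Δ * L⁻¹ ^ (k + 2)) = (R * L⁻¹) * (L⁻¹ ^ (k + 1) * Δ) := by
              rw [pow_succ _ (k + 1)]; ring
          _ ≤ 1 * (L⁻¹ ^ (k + 1) * Δ) := by gcongr
          _ = _ := one_mul _
      linarith
    refine le_trans (le_of_eq_of_le ?_ (?_ : (1 / 1728) * (Metric.diam E / Δ) ^ α ≤ _)) h2
    · rw [hdiv]; field_simp
    · rw [pow_add]; linarith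
  · have h1 : (1 / 12 : ℝ) ^ (k + 1) ≤ (Metric.diam E / Δ) ^ α := by
      rw [← hLα]; gcongr
    rw [div_le_iff₀ hΔ] at hk2
    have h2 : Metric.diam (f '' E) ≤ 3 * (1 / 12 : ℝ) ^ k := by
      refine Metric.diam_le_of_forall_dist_le (by positivity) ?_
      rintro _ ⟨x, hx, rfl⟩ _ ⟨y, hy, rfl⟩
      refine hup x y k ((Metric.dist_le_diam_of_mem hE.1.isBounded hx hy).trans ?_)
      rwa [mul_comm]
    refine h2.trans (le_of_le_of_eq (?_ : _ ≤ 36 * (Metric.diam E / Δ) ^ α) ?_)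
    · rw [pow_succ] at h1; linarith
    · rw [hdiv]; field_simp

/-- Two-sided Hölder control of the diameters of continua makes a map a branched quasisymmetry. -/
lemma isBranchedQuasisymmetry_of_holder {X : Type u} {Y : Type v} [MetricSpace X] [MetricSpace Y]
    {f : X → Y} (hf : Continuous f) {α A a : ℝ} (hα : 0 < α) (hA : 0 < A) (ha : 0 < a)
    (h : ∀ E : Set X, IsContinuumSet E → E.Nontrivial →
        a * Metric.diam E ^ α ≤ Metric.diam (f '' E) ∧
          Metric.diam (f '' E) ≤ A * Metric.diam E ^ α) : IsBranchedQuasisymmetry f := by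
  have hq : A / a ≠ 0 := by positivity
  let q : ℝ≥0 := ⟨A / a, by positivity⟩
  have hq0 : q ≠ 0 := fun h => hq (congrArg NNReal.toReal h)
  refine ⟨hf, ((NNReal.orderIsoRpow α hα).toHomeomorph.trans (Homeomorph.mulLeft₀ q hq0)), ?_⟩
  intro E E' hE hEn hE' hEn' _
  have hD := diam_pos_of_nontrivial hE.1 hEn
  have hD' := diam_pos_of_nontrivial hE'.1 hEn'
  have h1 := (h E hE hEn).2
  have h2 := (h E' hE' hEn').1
  have e : (((NNReal.orderIsoRpow α hα).toHomeomorph.trans (Homeomorph.mulLeft₀ q hq0))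
      (Real.toNNReal (Metric.diam E / Metric.diam E')) : ℝ)
      = A / a * (Metric.diam E / Metric.diam E') ^ α := by
    change ((q * Real.toNNReal (Metric.diam E / Metric.diam E') ^ α : ℝ≥0) : ℝ) = _
    rw [NNReal.coe_mul, NNReal.coe_rpow, Real.coe_toNNReal _ (div_pos hD hD').le]
    rfl
  rw [e, Real.div_rpow hD.le hD'.le]
  calc Metric.diam (f '' E) ≤ A * Metric.diam E ^ α := h1
    _ = A / a * (Metric.diam E ^ α / Metric.diam E' ^ α) * (a * Metric.diam E' ^ α) := by
        have : 0 < Metric.diam E' ^ α := by positivity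
        field_simp
    _ ≤ _ := by gcongr

/-- Subspaces of `ℝⁿ` have Assouad dimension at most `n`: cut a bounded set along a grid. -/
lemma assouadDim_le_of_isometry {Y : Type v} [MetricSpace Y] {n : ℕ} (hn : n ≠ 0)
    {g : Y → Fin n → ℝ} (hg : Isometry g) : assouadDim Y ≤ n := by
  refine sInf_le ⟨n, by positivity, by simp, 5 ^ n, by positivity, fun E hE ε hε hε1 => ?_⟩
  rcases Set.eq_empty_or_nonempty E with rfl | ⟨e, he⟩
  · exact ⟨∅, by simp; positivity, by simp, by simp⟩
  have hEb : Bornology.IsBounded E := Metric.isBounded_iff_ediam_ne_top.2 hE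
  set d := Metric.diam E with hd
  have hd0 : 0 ≤ d := Metric.diam_nonneg
  have hcoord : ∀ y ∈ E, ∀ z ∈ E, ∀ i, |g y i - g z i| ≤ d := by
    intro y hy z hz i
    have h1 := dist_le_pi_dist (g y) (g z) i
    rw [hg.dist_eq, Real.dist_eq] at h1
    exact h1.trans (Metric.dist_le_diam_of_mem hEb hy hz)
  -- If `d = 0`, then the quotient below is `0` by convention, and one cell is used.
  let cell : Y → Fin n → ℤ := fun z i => ⌊(g z i - g e i) / (ε * d)⌋
  set M : ℤ := ⌈1 / ε⌉ with hM
  have hM1 : (1 / ε : ℝ) ≤ M := Int.le_ceil _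
  have hM2 : (M : ℝ) < 1 / ε + 1 := Int.ceil_lt_add_one _
  have hM0 : 0 < M := Int.ceil_pos.2 (by positivity)
  have hq : ∀ z ∈ E, ∀ i, |(g z i - g e i) / (ε * d)| ≤ 1 / ε := by
    intro z hz i
    rw [abs_div, abs_of_nonneg (show 0 ≤ ε * d by positivity)]
    rcases hd0.eq_or_lt with h0 | h0
    · rw [← h0]; simp; positivity
    · rw [div_le_div_iff₀ (by positivity) hε]
      nlinarith [hcoord z hz e he i]
  have hcell : ∀ z ∈ E, cell z ∈ Fintype.piFinset fun _ : Fin n => Finset.Icc (-M) M := by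
    intro z hz
    refine Fintype.mem_piFinset.2 fun i => Finset.mem_Icc.2 ?_
    have h1 := abs_le.1 (hq z hz i)
    constructor
    · refine Int.le_floor.2 ?_
      push_cast; linarith
    · have h2 : cell z i ≤ (M : ℤ) := by
        have h3 : ((cell z i : ℤ) : ℝ) ≤ (g z i - g e i) / (ε * d) := Int.floor_le _
        exact_mod_cast h3.trans (h1.2.trans hM1)
      exact h2
  classical
  refine ⟨(Fintype.piFinset fun _ : Fin n => Finset.Icc (-M) M).image
    fun k => {z ∈ E | cell z = k}, ?_, ?_, ?_⟩
  · have h1 : ((Finset.Icc (-M) M).card : ℝ) ≤ 5 / ε := by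
      rw [Int.card_Icc]
      have h2 : ((M + 1 - -M).toNat : ℝ) = 2 * M + 1 := by
        have : ((M + 1 - -M).toNat : ℤ) = M + 1 - -M := Int.toNat_of_nonneg (by omega)
        have h3 : (((M + 1 - -M).toNat : ℤ) : ℝ) = ((M + 1 - -M : ℤ) : ℝ) := by rw [this]
        push_cast at h3
        rw [h3]; ring
      have h4 : 1 ≤ 1 / ε := by rw [le_div_iff₀ hε]; linarith
      have h5 : 5 / ε = 5 * (1 / ε) := by ring
      rw [h2, h5]; linarith
    calc _ ≤ ((Fintype.piFinset fun _ : Fin n => Finset.Icc (-M) M).card : ℝ) := by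
          exact_mod_cast Finset.card_image_le
      _ = ((Finset.Icc (-M) M).card : ℝ) ^ n := by simp [Fintype.card_piFinset]
      _ ≤ (5 / ε) ^ n := by gcongr
      _ = 5 ^ n * ε ^ (-(n : ℝ)) := by
          rw [Real.rpow_neg hε.le, Real.rpow_natCast, div_pow, div_eq_mul_inv]
  · intro z hz
    simp only [Set.mem_iUnion]
    exact ⟨_, Finset.mem_image_of_mem _ (hcell z hz), hz, rfl⟩
  · intro B hB
    obtain ⟨k, -, rfl⟩ := Finset.mem_image.1 hB
    have hED : Metric.ediam E = ENNReal.ofReal d := (ENNReal.ofReal_toReal hE).symm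
    rw [hED, ← ENNReal.ofReal_mul hε.le]
    refine Metric.ediam_le fun y hy z hz => ?_
    rw [edist_dist]
    refine ENNReal.ofReal_le_ofReal ?_
    rw [← hg.dist_eq]
    refine (dist_pi_le_iff (by positivity)).2 fun i => ?_
    rw [Real.dist_eq]
    rcases hd0.eq_or_lt with h0 | h0
    · have := hcoord y hy.1 z hz.1 i
      rw [← h0] at this ⊢
      simpa using this
    · have h1 : cell y i = cell z i := by rw [hy.2, hz.2]
      have h2 := Int.abs_sub_lt_one_of_floor_eq_floor h1
      have h3 : 0 < ε * d := by positivity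
      rw [← sub_div, abs_div, abs_of_pos h3, div_lt_one h3] at h2
      rw [show g y i - g z i = g y i - g e i - (g z i - g e i) by ring]
      exact h2.le

/-! ### Selection of radii -/

/-- Choosing one of `N` positions for a new sphere: each cover element is hit by at most one
position, so some position leaves, simultaneously for at most `Q` families, at most the fraction
`Q / N` of each family. -/
lemma exists_good_position {ι α : Type*} [DecidableEq α] {N Q : ℕ} (hN : 0 < N) (T : Finset ι)
    (hT : T.card ≤ Q) (F : ι → Finset α) (hit : α → Fin N → Prop)
    [∀ B m, Decidable (hit B m)]
    (hu : ∀ q ∈ T, ∀ B ∈ F q, ∀ m m', hit B m → hit B m' → m = m') :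
    ∃ m : Fin N, ∀ q ∈ T, N * ((F q).filter fun B => hit B m).card ≤ Q * (F q).card := by
  by_contra! hcon
  have h0 : ∀ q ∈ T, ∑ m : Fin N, ((F q).filter fun B => hit B m).card ≤ (F q).card := by
    intro q hq
    rw [← Finset.card_biUnion]
    · exact Finset.card_le_card (Finset.biUnion_subset.2 fun m _ => Finset.filter_subset _ _)
    · intro m _ m' _ hmm
      refine Finset.disjoint_left.2 fun B hB hB' => hmm ?_
      exact hu q hq B (Finset.mem_filter.1 hB).1 m m' (Finset.mem_filter.1 hB).2
        (Finset.mem_filter.1 hB').2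
  -- Counting the hit elements over all positions, each `q` rules out fewer than `N / Q` positions.
  set bad : ι → Finset (Fin N) := fun q =>
    Finset.univ.filter fun m => Q * (F q).card < N * ((F q).filter fun B => hit B m).card with hbad
  have hcov : (Finset.univ : Finset (Fin N)) ⊆ T.biUnion bad := by
    intro m _
    obtain ⟨q, hq, hm⟩ := hcon m
    exact Finset.mem_biUnion.2 ⟨q, hq, Finset.mem_filter.2 ⟨Finset.mem_univ _, hm⟩⟩
  have hQ : 0 < Q := by
    obtain ⟨q, hq, -⟩ := hcon ⟨0, hN⟩
    exact (Finset.card_pos.2 ⟨q, hq⟩).trans_le hT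
  have hb : ∀ q ∈ T, Q * (bad q).card < N := by
    intro q hq
    rcases Nat.eq_zero_or_pos (F q).card with hF | hF
    · have : bad q = ∅ := by
        refine Finset.filter_eq_empty_iff.2 fun m _ => ?_
        rw [Finset.card_eq_zero] at hF
        simp [hF]
      rw [this]; simpa using hN
    rcases (bad q).eq_empty_or_nonempty with he | hne
    · rw [he]; simpa using hN
    have h1 : (bad q).card * (Q * (F q).card) < N * (F q).card := by
      calc (bad q).card * (Q * (F q).card) = ∑ _m ∈ bad q, Q * (F q).card := by simp
        _ < ∑ m ∈ bad q, N * ((F q).filter fun B => hit B m).card :=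
            Finset.sum_lt_sum_of_nonempty hne fun m hm => (Finset.mem_filter.1 hm).2
        _ = N * ∑ m ∈ bad q, ((F q).filter fun B => hit B m).card := by rw [Finset.mul_sum]
        _ ≤ N * ∑ m : Fin N, ((F q).filter fun B => hit B m).card := by
            gcongr; exact Finset.subset_univ _
        _ ≤ _ := by gcongr; exact h0 q hq
    have h2 : (Q * (bad q).card) * (F q).card < N * (F q).card := by
      calc _ = (bad q).card * (Q * (F q).card) := by ring
        _ < _ := h1
    exact lt_of_mul_lt_mul_right h2 (Nat.zero_le _)
  have h1 : N ≤ ∑ q ∈ T, (bad q).card := by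
    calc N = (Finset.univ : Finset (Fin N)).card := by simp
      _ ≤ (T.biUnion bad).card := Finset.card_le_card hcov
      _ ≤ _ := Finset.card_biUnion_le
  have hTne : T.Nonempty := by
    obtain ⟨q, hq, -⟩ := hcon ⟨0, hN⟩
    exact ⟨q, hq⟩
  have h2 : Q * N < Q * N := by
    calc Q * N ≤ Q * ∑ q ∈ T, (bad q).card := by gcongr
      _ = ∑ q ∈ T, Q * (bad q).card := by rw [Finset.mul_sum]
      _ < ∑ _q ∈ T, N := Finset.sum_lt_sum_of_nonempty hTne hb
      _ = T.card * N := by simp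
      _ ≤ Q * N := by gcongr
  exact lt_irrefl _ h2

/-- Greedy choice of positions for finitely many spheres: each further sphere through a cluster of
neighbouring spheres reduces the number of elements of the covers `F l` by a factor `Q / N`. -/
lemma exists_positions {I α : Type*} [Fintype I] [DecidableEq I] [DecidableEq α] {N D : ℕ}
    (hN : 0 < N) (R : I → I → Prop) [∀ i j, Decidable (R i j)] (hsymm : ∀ i j, R i j → R j i)
    (hD : ∀ i, (Finset.univ.filter fun j => R i j).card ≤ D)
    (F : I → Finset α) (hit : α → I → Fin N → Prop) [∀ B i m, Decidable (hit B i m)]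
    (hu : ∀ l i, R l i → ∀ B ∈ F l, ∀ m m', hit B i m → hit B i m' → m = m') :
    ∃ p : I → Fin N, ∀ σ : Finset I, (∀ i ∈ σ, ∀ j ∈ σ, R i j) → ∀ l, (∀ i ∈ σ, R l i) →
      N ^ σ.card * ((F l).filter fun B => ∀ i ∈ σ, hit B i (p i)).card ≤
        (D * 2 ^ D) ^ σ.card * (F l).card := by
  suffices H : ∀ P : Finset I, ∃ p : I → Fin N, ∀ σ ⊆ P, (∀ i ∈ σ, ∀ j ∈ σ, R i j) →
      ∀ l, (∀ i ∈ σ, R l i) →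
      N ^ σ.card * ((F l).filter fun B => ∀ i ∈ σ, hit B i (p i)).card ≤
        (D * 2 ^ D) ^ σ.card * (F l).card by
    obtain ⟨p, hp⟩ := H Finset.univ
    exact ⟨p, fun σ => hp σ (Finset.subset_univ _)⟩
  intro P
  induction P using Finset.induction_on with
  | empty =>
    refine ⟨fun _ => ⟨0, hN⟩, fun σ hσ _ l _ => ?_⟩
    rw [Finset.subset_empty.1 hσ]; simp
  | insert i P hi ih =>
    obtain ⟨p, hp⟩ := ih
    set W := Finset.univ.filter fun j => R i j with hW
    obtain ⟨m, hm⟩ := exists_good_position (Q := D * 2 ^ D) hN (W ×ˢ W.powerset) (by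
        rw [Finset.card_product, Finset.card_powerset]
        exact Nat.mul_le_mul (hD i) (Nat.pow_le_pow_right (by norm_num) (hD i)))
      (fun q => (F q.1).filter fun B => ∀ j ∈ q.2, hit B j (p j)) (fun B m => hit B i m)
      (fun q hq B hB m m' => hu q.1 i
        (hsymm _ _ (Finset.mem_filter.1 (Finset.mem_product.1 hq).1).2) B
        (Finset.mem_filter.1 hB).1 m m')
    refine ⟨Function.update p i m, fun σ hσ hR l hl => ?_⟩
    have hupd : ∀ τ : Finset I, i ∉ τ → ∀ B,
        (∀ j ∈ τ, hit B j (Function.update p i m j)) ↔ ∀ j ∈ τ, hit B j (p j) := by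
      intro τ hτ B
      refine forall₂_congr fun j hj => ?_
      rw [Function.update_of_ne (ne_of_mem_of_not_mem hj hτ)]
    by_cases his : i ∈ σ
    · set τ := σ.erase i with hτ
      have hiτ : i ∉ τ := Finset.notMem_erase i σ
      have hστ : insert i τ = σ := Finset.insert_erase his
      have hτP : τ ⊆ P := by
        intro j hj
        have h1 := hσ (Finset.mem_of_mem_erase hj)
        exact (Finset.mem_insert.1 h1).resolve_left (Finset.ne_of_mem_erase hj)
      have hτσ : τ ⊆ σ := Finset.erase_subset _ _
      have h1 := hp τ hτP (fun a ha b hb => hR a (hτσ ha) b (hτσ hb)) l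
        (fun a ha => hl a (hτσ ha))
      have h2 := hm (l, τ) (Finset.mem_product.2
        ⟨Finset.mem_filter.2 ⟨Finset.mem_univ _, hsymm _ _ (hl i his)⟩, Finset.mem_powerset.2
          fun j hj => Finset.mem_filter.2 ⟨Finset.mem_univ _, hR i his j (hτσ hj)⟩⟩)
      have h3 : ((F l).filter fun B => ∀ j ∈ σ, hit B j (Function.update p i m j)) =
          ((F l).filter fun B => ∀ j ∈ τ, hit B j (p j)).filter fun B => hit B i m := by
        ext B
        rw [← hστ, Finset.mem_filter, Finset.mem_filter, Finset.mem_filter,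
          Finset.forall_mem_insert, hupd τ hiτ, Function.update_self]
        tauto
      have hcard : σ.card = τ.card + 1 := by rw [← hστ, Finset.card_insert_of_notMem hiτ]
      rw [h3, hcard, pow_succ, pow_succ]
      simp only at h2
      calc _ = N ^ τ.card * (N * (((F l).filter fun B => ∀ j ∈ τ, hit B j (p j)).filter
              fun B => hit B i m).card) := by ring
        _ ≤ N ^ τ.card * (D * 2 ^ D * ((F l).filter fun B => ∀ j ∈ τ, hit B j (p j)).card) := by
            gcongr
        _ = D * 2 ^ D * (N ^ τ.card * ((F l).filter fun B => ∀ j ∈ τ, hit B j (p j)).card) := by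
            ring
        _ ≤ D * 2 ^ D * ((D * 2 ^ D) ^ τ.card * (F l).card) := by gcongr
        _ = _ := by ring
    · have hσP : σ ⊆ P := fun j hj =>
        (Finset.mem_insert.1 (hσ hj)).resolve_left fun h => his (h ▸ hj)
      simp_rw [hupd σ his]
      exact hp σ hσP hR l hl

/-- The covering condition in the definition of the Assouad dimension, with exponent `β` and
constant `C`. -/
def AssouadBound (Y : Type v) [MetricSpace Y] (C β : ℝ) : Prop :=
  ∀ E : Set Y, Metric.ediam E ≠ ⊤ → ∀ ε : ℝ, 0 < ε → ε < 1 →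
    ∃ F : Finset (Set Y), (F.card : ℝ) ≤ C * ε ^ (-β) ∧
      E ⊆ ⋃ B ∈ F, B ∧ ∀ B ∈ F, Metric.ediam B ≤ ENNReal.ofReal ε * Metric.ediam E

lemma AssouadBound.exists_cover_closedBall {Y : Type v} [MetricSpace Y] {C β : ℝ}
    (h : AssouadBound Y C β) (y : Y) {r ε : ℝ} (hr : 0 < r) (hε : 0 < ε) (hε1 : ε < 1) :
    ∃ F : Finset (Set Y), (F.card : ℝ) ≤ C * ε ^ (-β) ∧
      (∀ z, dist z y ≤ r → ∃ B ∈ F, z ∈ B) ∧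
        ∀ B ∈ F, ∀ z ∈ B, ∀ z' ∈ B, dist z z' ≤ ε * (2 * r) := by
  have hE : Metric.ediam (Metric.closedBall y r) ≤ ENNReal.ofReal (2 * r) := by
    refine Metric.ediam_le fun z hz z' hz' => ?_
    rw [edist_dist]
    refine ENNReal.ofReal_le_ofReal ?_
    have := dist_triangle_right z z' y
    rw [Metric.mem_closedBall] at hz hz'
    linarith
  obtain ⟨F, hF1, hF2, hF3⟩ :=
    h (Metric.closedBall y r) (hE.trans_lt ENNReal.ofReal_lt_top).ne ε hε hε1
  refine ⟨F, hF1, fun z hz => ?_, fun B hB z hz z' hz' => ?_⟩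
  · simpa using hF2 (Metric.mem_closedBall.2 hz)
  · have h1 := (Metric.edist_le_ediam_of_mem hz hz').trans (hF3 B hB)
    have h2 : edist z z' ≤ ENNReal.ofReal (ε * (2 * r)) := by
      rw [ENNReal.ofReal_mul hε.le]
      exact h1.trans (by gcongr)
    rwa [edist_dist, ENNReal.ofReal_le_ofReal_iff (by positivity)] at h2

/-- Two balls are neighbours if their scales agree up to the factor `H` and the balls of four times
these scales may meet. -/
def BallNeighbor {I Y : Type*} [MetricSpace Y] (H : ℝ) (y : I → Y) (ρ : I → ℝ) (i j : I) : Prop :=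
  ρ i ≤ H * ρ j ∧ ρ j ≤ H * ρ i ∧ dist (y i) (y j) ≤ 4 * (ρ i + ρ j)

open Classical in
/-- A union of separated nets at dyadic scales has boundedly many neighbours everywhere. -/
lemma AssouadBound.exists_neighbor_bound {Y : Type v} [MetricSpace Y] {C β H : ℝ}
    (h : AssouadBound Y C β) (hH : 1 ≤ H) :
    ∃ D : ℕ, ∀ {I : Type v} [Fintype I] (e : I → ℤ) (y : I → Y),
      (∀ i j, i ≠ j → e i = e j → (2 : ℝ) ^ e i ≤ dist (y i) (y j)) →
        ∀ i, (Finset.univ.filter fun j =>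
          BallNeighbor H y (fun i => (2 : ℝ) ^ e i) i j).card ≤ D := by
  obtain ⟨w, hw⟩ := pow_unbounded_of_one_lt H (one_lt_two)
  -- Then an element of the cover contains at most one point of the net at each comparable scale.
  set ε : ℝ := 1 / (16 * (1 + H) * H) with hε
  have hε0 : 0 < ε := by positivity
  have hε1 : ε < 1 := by
    rw [hε, div_lt_one (by positivity)]; nlinarith
  refine ⟨⌊C * ε ^ (-β)⌋₊ * (2 * w + 1), fun {I} _ e y hsep i => ?_⟩
  have hcmp : ∀ a b : ℤ, (2 : ℝ) ^ a ≤ H * 2 ^ b → a ≤ b + w := by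
    intro a b hab
    have h1 : (2 : ℝ) ^ a < 2 ^ (b + w) := by
      rw [zpow_add₀ two_ne_zero, zpow_natCast, mul_comm]
      exact hab.trans_lt (by gcongr)
    exact ((zpow_lt_zpow_iff_right₀ one_lt_two).1 h1).le
  have hcard : (Finset.Icc (e i - w) (e i + w)).card = 2 * w + 1 := by
    rw [Int.card_Icc]; omega
  rw [← hcard]
  refine Finset.card_le_mul_card_image_of_maps_to (f := e) (fun j hj => ?_) _ fun b _ => ?_
  · obtain ⟨-, h1, h2, -⟩ := Finset.mem_filter.1 hj
    have h3 := hcmp _ _ h1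
    have h4 := hcmp _ _ h2
    rw [Finset.mem_Icc]
    constructor <;> linarith
  · set ρ : ℝ := 2 ^ e i with hρ
    have hρ0 : 0 < ρ := by positivity
    obtain ⟨F, hF1, hF2, hF3⟩ := h.exists_cover_closedBall (y i)
      (show 0 < 4 * (1 + H) * ρ by positivity) hε0 hε1
    refine le_trans ?_ (Nat.le_floor hF1)
    have hmem : ∀ j ∈ (Finset.univ.filter fun j =>
        BallNeighbor H y (fun i => (2 : ℝ) ^ e i) i j).filter fun j => e j = b,
        ∃ B ∈ F, y j ∈ B := by
      intro j hj
      obtain ⟨-, h1, h2, h3⟩ := Finset.mem_filter.1 (Finset.mem_filter.1 hj).1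
      refine hF2 _ ?_
      rw [dist_comm]
      simp only at h1 h2 h3
      refine h3.trans ?_
      rw [← hρ] at h2 ⊢
      linarith
    choose! g hgF hg using hmem
    refine Finset.card_le_card_of_injOn g hgF fun j hj j' hj' hgg => ?_
    by_contra hne
    have hj1 := Finset.mem_filter.1 hj
    have hj1' := Finset.mem_filter.1 hj'
    have h1 := hsep j j' hne (hj1.2.trans hj1'.2.symm)
    have h2 := hF3 _ (hgF j hj) _ (hg j hj) _ (hgg ▸ hg j' hj')
    obtain ⟨-, h3, -, -⟩ := Finset.mem_filter.1 hj1.1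
    simp only at h3
    rw [← hρ] at h3
    have h4 : ε * (2 * (4 * (1 + H) * ρ)) = ρ / H / 2 := by
      rw [hε]; field_simp; norm_num
    have h5 : ρ / H ≤ 2 ^ e j := by rw [div_le_iff₀ (by positivity)]; linarith
    have h6 : (0 : ℝ) < 2 ^ e j := by positivity
    linarith

open Classical in
/-- If the Assouad exponent `β` of `Y` is less than `n + 1`, then the radii of a locally bounded
family of balls can be chosen so that at most `n` thin spheres of comparable radii meet in a point:
the covering numbers of intersections of `n + 1` thin spheres are smaller than `1`. -/
lemma AssouadBound.exists_radii {Y : Type v} [MetricSpace Y] {C β H : ℝ} {n : ℕ}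
    (h : AssouadBound Y C β) (hβ : β < n + 1) (hH : 1 ≤ H) (D : ℕ) :
    ∃ κ : ℝ, 0 < κ ∧ κ ≤ 1 ∧ ∀ {I : Type v} [Fintype I] (y : I → Y) (ρ : I → ℝ), (∀ i, 0 < ρ i) →
      (∀ i, (Finset.univ.filter fun j => BallNeighbor H y ρ i j).card ≤ D) →
      ∃ t : I → ℝ, (∀ i, 2 * ρ i ≤ t i ∧ t i ≤ 3 * ρ i) ∧
        ∀ σ : Finset I, (∀ i ∈ σ, ∀ j ∈ σ, ρ i ≤ H * ρ j) →
          ∀ z, (∀ i ∈ σ, |dist z (y i) - t i| ≤ κ * ρ i) → σ.card ≤ n := by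
  set Q := D * 2 ^ D with hQ
  -- A cluster of `n + 1` spheres leaves at most `(Q / N) ^ (n + 1) * C * (32 * N * H) ^ β` cover elements,
  -- which is less than `1` for large `N`.
  obtain ⟨N, hNpos, hN⟩ : ∃ N : ℕ, 0 < N ∧
      (Q : ℝ) ^ (n + 1) * (C * (32 * H) ^ β) * (N : ℝ) ^ β < (N : ℝ) ^ (n + 1) := by
    have hlim : Filter.Tendsto (fun N : ℕ => (N : ℝ) ^ ((n : ℝ) + 1 - β)) Filter.atTop
        Filter.atTop := (tendsto_rpow_atTop (by linarith)).comp tendsto_natCast_atTop_atTop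
    obtain ⟨N, hN1, hN2⟩ := ((hlim.eventually_gt_atTop
      ((Q : ℝ) ^ (n + 1) * (C * (32 * H) ^ β))).and (Filter.eventually_gt_atTop 0)).exists
    have hN0 : (0 : ℝ) < N := by exact_mod_cast hN2
    refine ⟨N, hN2, ?_⟩
    calc _ < (N : ℝ) ^ ((n : ℝ) + 1 - β) * (N : ℝ) ^ β := by gcongr
      _ = (N : ℝ) ^ (n + 1) := by
        rw [← Real.rpow_add hN0, ← Real.rpow_natCast]; congr 1; push_cast; ring
  have hN0 : (0 : ℝ) < N := by exact_mod_cast hNpos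
  have hN1 : (1 : ℝ) ≤ N := by exact_mod_cast hNpos
  -- At this relative scale, elements of the cover at `l` have diameter at most `ρ l / (4 * N * H)`.
  -- Hence they are hit by at most one of the `N` thin spheres with radii spaced by `ρ i / N`.
  set ε : ℝ := 1 / (32 * N * H) with hε
  have hε0 : 0 < ε := by positivity
  have hε1 : ε < 1 := by
    rw [hε, div_lt_one (by positivity)]; nlinarith
  refine ⟨1 / (4 * N), by positivity, ?_, fun {I} _ y ρ hρ hdeg => ?_⟩
  · rw [div_le_one (by positivity)]; linarith
  choose F hF1 hF2 hF3 using fun l => h.exists_cover_closedBall (y l)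
    (show 0 < 4 * ρ l by linarith [hρ l]) hε0 hε1
  set T : I → Fin N → ℝ := fun i m => ρ i * (2 + (m : ℕ) / N) with hT
  set hit : Set Y → I → Fin N → Prop := fun B i m =>
    ∃ z ∈ B, |dist z (y i) - T i m| ≤ 1 / (4 * N) * ρ i with hhit
  obtain ⟨p, hp⟩ := exists_positions hNpos (BallNeighbor H y ρ)
    (fun i j hij => ⟨hij.2.1, hij.1, by rw [dist_comm, add_comm]; exact hij.2.2⟩) hdeg F hit (by
    rintro l i hR B hB m m' ⟨z, hz, hzm⟩ ⟨z', hz', hzm'⟩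
    have h1 := hF3 l B hB z hz z' hz'
    have h2 : ε * (2 * (4 * ρ l)) ≤ ρ i / (4 * N) := by
      have : ε * (2 * (4 * ρ l)) = ρ l / H / (4 * N) := by rw [hε]; field_simp; norm_num
      rw [this]
      gcongr
      rw [div_le_iff₀ (by positivity)]; linarith [hR.1]
    have h3 := (abs_dist_sub_le z z' (y i)).trans (h1.trans h2)
    have h4 : |T i m - T i m'| ≤ 3 * (ρ i / (4 * N)) := by
      have e : 1 / (4 * N) * ρ i = ρ i / (4 * N) := by ring
      rw [e] at hzm hzm'
      rw [abs_le] at *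
      constructor <;> linarith
    have h5 : T i m - T i m' = (((m : ℕ) : ℝ) - ((m' : ℕ) : ℝ)) * (ρ i / N) := by
      simp only [hT]; field_simp; ring
    have h6 : 0 < ρ i / N := div_pos (hρ i) hN0
    have h7 : 3 * (ρ i / (4 * N)) = 3 / 4 * (ρ i / N) := by field_simp
    rw [h5, abs_mul, abs_of_pos h6, h7] at h4
    have h8 := le_of_mul_le_mul_right h4 h6
    have h9 : |((m : ℕ) : ℤ) - ((m' : ℕ) : ℤ)| < 1 := by
      have : (|((m : ℕ) : ℤ) - ((m' : ℕ) : ℤ)| : ℝ) < 1 := by push_cast; linarith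
      exact_mod_cast this
    rw [Int.abs_lt_one_iff] at h9
    ext; omega)
  refine ⟨fun i => T i (p i), fun i => ⟨?_, ?_⟩, fun σ hσ z hz => ?_⟩
  · have : 0 ≤ ((p i : ℕ) : ℝ) / N := by positivity
    simp only [hT]; nlinarith [hρ i]
  · have : ((p i : ℕ) : ℝ) / N ≤ 1 := by
      rw [div_le_one hN0]; exact_mod_cast (p i).2.le
    simp only [hT]; nlinarith [hρ i]
  · by_contra! hcard
    obtain ⟨τ, hτσ, hτ⟩ := Finset.exists_subset_card_eq (Nat.succ_le_of_lt hcard)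
    have hd : ∀ i ∈ τ, dist z (y i) ≤ 4 * ρ i := by
      intro i hi
      have h1 := (abs_le.1 (hz i (hτσ hi))).2
      have h2 : T i (p i) ≤ 3 * ρ i := by
        have : ((p i : ℕ) : ℝ) / N ≤ 1 := by
          rw [div_le_one hN0]; exact_mod_cast (p i).2.le
        simp only [hT]; nlinarith [hρ i]
      have h3 : 1 / (4 * N) * ρ i ≤ 1 * ρ i := by
        have := (hρ i).le
        gcongr
        rw [div_le_one (by positivity)]; linarith
      linarith
    have hR : ∀ i ∈ τ, ∀ j ∈ τ, BallNeighbor H y ρ i j := by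
      intro i hi j hj
      refine ⟨hσ i (hτσ hi) j (hτσ hj), hσ j (hτσ hj) i (hτσ hi), ?_⟩
      have := dist_triangle_left (y i) (y j) z
      linarith [hd i hi, hd j hj]
    obtain ⟨l, hl⟩ : τ.Nonempty := Finset.card_pos.1 (by omega)
    have h1 := hp τ hR l (hR l hl)
    obtain ⟨B, hB, hzB⟩ := hF2 l z (hd l hl)
    have h2 : 0 < ((F l).filter fun B => ∀ i ∈ τ, hit B i (p i)).card :=
      Finset.card_pos.2 ⟨B, Finset.mem_filter.2 ⟨hB, fun i hi => ⟨z, hzB, hz i (hτσ hi)⟩⟩⟩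
    have h3 : N ^ (n + 1) ≤ Q ^ (n + 1) * (F l).card := by
      rw [hτ] at h1
      exact (Nat.le_mul_of_pos_right _ h2).trans h1
    have h4 : (N : ℝ) ^ (n + 1) ≤ (Q : ℝ) ^ (n + 1) * (F l).card := by exact_mod_cast h3
    have h5 : ε ^ (-β) = (32 * H) ^ β * (N : ℝ) ^ β := by
      rw [hε, one_div, Real.inv_rpow (by positivity), Real.rpow_neg (by positivity), inv_inv,
        ← Real.mul_rpow (by positivity) (by positivity)]
      congr 1; ring
    have h6 : (Q : ℝ) ^ (n + 1) * (F l).card ≤ (Q : ℝ) ^ (n + 1) * (C * ε ^ (-β)) := by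
      gcongr; exact hF1 l
    rw [h5] at h6
    have h7 : (Q : ℝ) ^ (n + 1) * (C * ((32 * H) ^ β * (N : ℝ) ^ β)) =
      (Q : ℝ) ^ (n + 1) * (C * (32 * H) ^ β) * (N : ℝ) ^ β := by ring
    linarith

/-! ### Scales of a branched quasisymmetry -/

/-- A decreasing homeomorphism is impossible, since it would be bounded by its value at `0`. -/
lemma NNReal.homeomorph_strictMono (η : ℝ≥0 ≃ₜ ℝ≥0) : StrictMono η := by
  rcases η.continuous.strictMono_of_inj η.injective with h | h
  · exact h
  · obtain ⟨x, hx⟩ := η.surjective (η 0 + 1)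
    have h1 := h.antitone (zero_le (a := x))
    rw [hx] at h1
    exact absurd h1 (by simp)

lemma NNReal.homeomorph_zero (η : ℝ≥0 ≃ₜ ℝ≥0) : η 0 = 0 := by
  obtain ⟨x, hx⟩ := η.surjective 0
  have h1 : η 0 ≤ η x := (NNReal.homeomorph_strictMono η).monotone zero_le
  exact le_antisymm (hx ▸ h1) zero_le

/-- A maximal `δ`-separated set in a compact space is a finite `δ`-net. -/
lemma exists_finite_separated_net (Y : Type v) [MetricSpace Y] [CompactSpace Y] {δ : ℝ}
    (hδ : 0 < δ) : ∃ N : Set Y, N.Finite ∧ (∀ y ∈ N, ∀ z ∈ N, y ≠ z → δ ≤ dist y z) ∧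
      ∀ z, ∃ y ∈ N, dist z y ≤ δ := by
  have hne : Metric.packingNumber δ.toNNReal (Set.univ : Set Y) ≠ ⊤ := by
    obtain ⟨N, -, hN, hc⟩ := Metric.exists_finite_isCover_of_isCompact (X := Y) (s := Set.univ)
      (ε := (δ / 2).toNNReal) (by simpa using hδ) isCompact_univ
    have h1 := Metric.packingNumber_two_mul_le_externalCoveringNumber (δ / 2).toNNReal
      (Set.univ : Set Y)
    have h2 : 2 * (δ / 2).toNNReal = δ.toNNReal := by
      ext
      rw [NNReal.coe_mul, Real.coe_toNNReal _ hδ.le, Real.coe_toNNReal _ (by positivity)]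
      push_cast; ring
    rw [h2] at h1
    exact (h1.trans_lt (hc.externalCoveringNumber_le_encard.trans_lt hN.encard_lt_top)).ne
  obtain ⟨hsep, hcov⟩ := And.intro
    (Metric.isSeparated_maximalSeparatedSet (ε := δ.toNNReal) (A := (Set.univ : Set Y)))
    (Metric.isCover_maximalSeparatedSet hne)
  refine ⟨Metric.maximalSeparatedSet δ.toNNReal Set.univ, ?_, fun y hy z hz hyz => ?_, fun z => ?_⟩
  · rw [← Set.encard_ne_top_iff, Metric.encard_maximalSeparatedSet hne]
    exact hne
  · have h1 : ENNReal.ofReal δ < edist y z := hsep hy hz hyz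
    rw [edist_dist] at h1
    exact ((ENNReal.ofReal_lt_ofReal_iff_of_nonneg hδ.le).1 h1).le
  · obtain ⟨y, hy, hzy⟩ := hcov (Set.mem_univ z)
    refine ⟨y, hy, ?_⟩
    have h1 : edist z y ≤ ENNReal.ofReal δ := hzy
    rwa [edist_dist, ENNReal.ofReal_le_ofReal_iff hδ.le] at h1

lemma IsContinuumSet.union {X : Type u} [MetricSpace X] {K L : Set X} (hK : IsContinuumSet K)
    (hL : IsContinuumSet L) {x : X} (hx : x ∈ K) (hx' : x ∈ L) : IsContinuumSet (K ∪ L) :=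
  ⟨hK.1.union hL.1, IsConnected.union ⟨x, hx, hx'⟩ hK.2 hL.2⟩

lemma IsBoundedTurning.connectedSpace {X : Type u} [MetricSpace X] [Nonempty X]
    (h : IsBoundedTurning X) : ConnectedSpace X := by
  obtain ⟨C, -, h⟩ := h
  have : PreconnectedSpace X := ⟨isPreconnected_of_forall_pair fun x _ y _ => by
    obtain ⟨K, hK, hx, hy, -⟩ := h x y
    exact ⟨K, Set.subset_univ K, hx, hy, hK.2.isPreconnected⟩⟩
  exact ⟨inferInstance⟩

/-- In a compact bounded turning space there are continua of any small size around each point. -/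
lemma exists_continuum_of_scale {X : Type u} [MetricSpace X] [CompactSpace X] [ConnectedSpace X]
    {C : ℝ} (hC : ∀ x y : X, ∃ K : Set X, IsContinuumSet K ∧ x ∈ K ∧ y ∈ K ∧
      Metric.diam K ≤ C * dist x y) {s : ℝ} (hs : 0 < s)
    (hsd : s < Metric.diam (Set.univ : Set X) / 2) (x : X) :
    ∃ E : Set X, IsContinuumSet E ∧ x ∈ E ∧ s ≤ Metric.diam E ∧ Metric.diam E ≤ C * s := by
  obtain ⟨z, hz⟩ : ∃ z, s ≤ dist x z := by
    by_contra! hcon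
    have : Metric.diam (Set.univ : Set X) ≤ 2 * s :=
      Metric.diam_le_of_forall_dist_le (by positivity) fun y _ z _ => by
        have := dist_triangle_left y z x
        linarith [hcon y, hcon z]
    linarith
  obtain ⟨y, hy⟩ : ∃ y, dist x y = s :=
    intermediate_value_univ x z (continuous_const.dist continuous_id)
      ⟨by simpa using hs.le, hz⟩
  obtain ⟨K, hK, hxK, hyK, hd⟩ := hC x y
  rw [hy] at hd
  exact ⟨K, hK, hxK, hy ▸ Metric.dist_le_diam_of_mem hK.1.isBounded hxK hyK, hd⟩

/-- For a non-constant branched quasisymmetry `f`, the image scale `r x` of the scale `s` at `x`: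
images of continua through `x` of size about `s` have size about `r x`, and conversely. All constants
are independent of `s`. -/
lemma IsBranchedQuasisymmetry.exists_image_scale {X : Type u} {Y : Type v} [MetricSpace X]
    [MetricSpace Y] [CompactSpace X] [ConnectedSpace X] {f : X → Y} (hf : Continuous f)
    {η : ℝ≥0 ≃ₜ ℝ≥0} (hη : ∀ E E' : Set X,
      IsContinuumSet E → E.Nontrivial → IsContinuumSet E' → E'.Nontrivial → (E ∩ E').Nonempty →
      Metric.diam (f '' E) ≤
        (η (Real.toNNReal (Metric.diam E / Metric.diam E')) : ℝ) * Metric.diam (f '' E'))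
    (hne : ∃ x x', f x ≠ f x') {C : ℝ} (hC0 : 1 ≤ C)
    (hC : ∀ x y : X, ∃ K : Set X, IsContinuumSet K ∧ x ∈ K ∧ y ∈ K ∧
      Metric.diam K ≤ C * dist x y) :
    ∃ A : ℝ, 0 < A ∧ ∀ s : ℝ, 0 < s → s < Metric.diam (Set.univ : Set X) / 2 →
      ∃ r : X → ℝ, (∃ m M, 0 < m ∧ ∀ x, m ≤ r x ∧ r x ≤ M) ∧
        (∀ D : ℝ, 0 ≤ D → ∀ L : Set X, IsContinuumSet L → ∀ x ∈ L, Metric.diam L ≤ D * s →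
          Metric.diam (f '' L) ≤ η D.toNNReal * r x) ∧
        (∀ L : Set X, IsContinuumSet L → ∀ x ∈ L, Metric.diam (f '' L) ≤ 8 * r x →
          Metric.diam L ≤ A * s) ∧
        ∀ D : ℝ, 0 ≤ D → ∀ x x', dist x x' ≤ D * s → r x' ≤ η (C * D + C).toNNReal * r x := by
  have hmono : StrictMono η := NNReal.homeomorph_strictMono η
  have hη0 : η 0 = 0 := NNReal.homeomorph_zero η
  set q : ℝ≥0 := η.symm (1 / 9) with hq
  have hηq : η q = 1 / 9 := η.apply_symm_apply _
  have hq0 : 0 < q := by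
    rcases eq_or_ne q 0 with h | h
    · rw [h, hη0] at hηq; norm_num at hηq
    · exact pos_iff_ne_zero.2 h
  refine ⟨C / q, by positivity, fun s hs hsd => ?_⟩
  choose E hE hxE hEs hEC using exists_continuum_of_scale hC hs hsd
  have hEn : ∀ x, (E x).Nontrivial := by
    intro x
    by_contra h
    have := Metric.diam_subsingleton (Set.not_nontrivial_iff.1 h)
    linarith [hEs x]
  have htriv : ∀ L : Set X, ¬ L.Nontrivial → Metric.diam (f '' L) = 0 := fun L h =>
    Metric.diam_subsingleton ((Set.not_nontrivial_iff.1 h).image f)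
  have hfact : ∀ D : ℝ, 0 ≤ D → ∀ L : Set X, IsContinuumSet L → ∀ x ∈ L, Metric.diam L ≤ D * s →
      Metric.diam (f '' L) ≤ η D.toNNReal * Metric.diam (f '' E x) := by
    intro D hD L hL x hx hLD
    by_cases hLn : L.Nontrivial
    · refine (hη L (E x) hL hLn (hE x) (hEn x) ⟨x, hx, hxE x⟩).trans ?_
      have h0 : 0 ≤ Metric.diam (f '' E x) := Metric.diam_nonneg
      gcongr
      refine NNReal.coe_le_coe.2 (hmono.monotone (Real.toNNReal_le_toNNReal ?_))
      rw [div_le_iff₀ (hs.trans_le (hEs x))]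
      exact hLD.trans (by gcongr; exact hEs x)
    · rw [htriv L hLn]
      have h0 : 0 ≤ Metric.diam (f '' E x) := Metric.diam_nonneg
      positivity
  obtain ⟨x₁, x₂, hne⟩ := hne
  have hnt : (Set.univ : Set X).Nontrivial := ⟨x₁, trivial, x₂, trivial, fun h => hne (h ▸ rfl)⟩
  set Z := Metric.diam (f '' Set.univ) with hZ
  have hZ0 : 0 < Z := (dist_pos.2 hne).trans_le
    (Metric.dist_le_diam_of_mem (isCompact_univ.image hf).isBounded
      ⟨x₁, trivial, rfl⟩ ⟨x₂, trivial, rfl⟩)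
  set W := (η (Metric.diam (Set.univ : Set X) / s).toNNReal : ℝ) with hW
  have hW0 : 0 ≤ W := NNReal.coe_nonneg _
  have hlower : ∀ x, Z ≤ W * Metric.diam (f '' E x) := fun x =>
    hfact _ (div_nonneg Metric.diam_nonneg hs.le) Set.univ ⟨isCompact_univ, isConnected_univ⟩ x
      trivial (by rw [div_mul_cancel₀ _ hs.ne'])
  have hrpos : ∀ x, 0 < Metric.diam (f '' E x) := fun x =>
    pos_of_mul_pos_right (hZ0.trans_le (hlower x)) hW0
  refine ⟨fun x => Metric.diam (f '' E x), ⟨Z / (W + 1), Z, by positivity, fun x => ⟨?_, ?_⟩⟩,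
    hfact, fun L hL x hx hLr => ?_, fun D hD x x' hxx => ?_⟩
  · rw [div_le_iff₀ (by positivity)]
    linarith [hlower x, hrpos x]
  · exact Metric.diam_mono (Set.image_mono (Set.subset_univ _))
      (isCompact_univ.image hf).isBounded
  · by_cases hLn : L.Nontrivial
    · have h1 := hη (E x) L (hE x) (hEn x) hL hLn ⟨x, hxE x, hx⟩
      have hL0 : 0 < Metric.diam L := diam_pos_of_nontrivial hL.1 hLn
      by_contra! hcon
      have h2 : (Metric.diam (E x) / Metric.diam L).toNNReal ≤ q := by
        rw [Real.toNNReal_le_iff_le_coe, div_le_iff₀ hL0]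
        have h3 : C * s < q * Metric.diam L := by
          have : C / q * s * q < Metric.diam L * q := by gcongr
          have e : C / q * s * q = C * s := by field_simp
          rw [e] at this; linarith
        linarith [hEC x]
      have h3 : (η (Metric.diam (E x) / Metric.diam L).toNNReal : ℝ) ≤ 1 / 9 := by
        have := hmono.monotone h2
        rw [hηq] at this
        exact_mod_cast this
      have h4 : 0 ≤ Metric.diam (f '' L) := Metric.diam_nonneg
      have h5 := h1.trans (mul_le_mul_of_nonneg_right h3 h4)
      linarith [hrpos x]
    · rw [Metric.diam_subsingleton (Set.not_nontrivial_iff.1 hLn)]; positivity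
  · obtain ⟨K, hK, hxK, hxK', hd⟩ := hC x x'
    have hU := hK.union (hE x') hxK' (hxE x')
    have h1 : Metric.diam (K ∪ E x') ≤ (C * D + C) * s := by
      refine (Metric.diam_union hxK' (hxE x')).trans ?_
      rw [dist_self]
      have : C * dist x x' ≤ C * (D * s) := by gcongr
      linarith [hEC x']
    refine le_trans ?_ (hfact _ (by positivity) _ hU x (Or.inl hxK) h1)
    exact Metric.diam_mono (Set.image_mono Set.subset_union_right) (hU.1.image hf).isBounded

/-! ### Nagata dimension of the domain of a branched quasisymmetry -/

lemma NNReal.homeomorph_exists_small (η : ℝ≥0 ≃ₜ ℝ≥0) {T b ζ δ₁ : ℝ} (hT : 0 < T) (hb : 0 ≤ b)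
    (hζ : 0 < ζ) (hδ₁ : 0 < δ₁) :
    ∃ δ : ℝ, 0 < δ ∧ δ ≤ δ₁ ∧ (η (T * δ).toNNReal : ℝ) * b ≤ ζ := by
  set p : ℝ≥0 := η.symm (Real.toNNReal (ζ / (b + 1))) with hp
  have hηp : (η p : ℝ) = ζ / (b + 1) := by
    rw [hp, η.apply_symm_apply, Real.coe_toNNReal _ (by positivity)]
  have hp0 : 0 < p := by
    refine pos_iff_ne_zero.2 fun h0 => ?_
    have h2 : (η p : ℝ) ≤ 0 := by rw [h0, NNReal.homeomorph_zero]; simp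
    rw [hηp] at h2
    have : 0 < ζ / (b + 1) := by positivity
    linarith
  have hpR : (0 : ℝ) < p := by exact_mod_cast hp0
  refine ⟨min δ₁ (p / T), by positivity, min_le_left _ _, ?_⟩
  have h1 : (T * min δ₁ (p / T)).toNNReal ≤ p := by
    rw [Real.toNNReal_le_iff_le_coe, mul_comm, ← le_div_iff₀ hT]
    exact min_le_right _ _
  have h2 : (η (T * min δ₁ (p / T)).toNNReal : ℝ) ≤ η p :=
    NNReal.coe_le_coe.2 ((NNReal.homeomorph_strictMono η).monotone h1)
  calc _ ≤ (η p : ℝ) * (b + 1) := mul_le_mul h2 (by linarith) hb (NNReal.coe_nonneg _)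
    _ = ζ := by rw [hηp]; field_simp

/-- A chain whose steps are joined by continua with small images, and whose points avoid a thin
sphere around `y₀`, stays in the preimage of the ball bounded by this sphere. Hence it is confined to
the size of the continua in this preimage. -/
lemma dist_le_of_chain_avoiding_sphere {X : Type u} {Y : Type v} [MetricSpace X] [MetricSpace Y]
    {f : X → Y} (hf : Continuous f) {r : X → X → Prop} {G : X → Prop} {x₀ x : X} {y₀ : Y}
    {t ζ M : ℝ} (hζ : 0 < ζ)
    (hconf : ∀ K : Set X, IsContinuumSet K → x₀ ∈ K → (∀ z ∈ K, dist (f z) y₀ ≤ t) →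
      Metric.diam K ≤ M)
    (hjoin : ∀ x x', r x x' → dist x₀ x ≤ M → ∃ L, IsContinuumSet L ∧ x ∈ L ∧ x' ∈ L ∧
      Metric.diam (f '' L) ≤ ζ)
    (hG : ∀ x x', r x x' → G x → G x')
    (hsphere : ∀ x, G x → dist x₀ x ≤ M → 2 * ζ ≤ |dist (f x) y₀ - t|)
    (hx₀ : dist (f x₀) y₀ < t) (hGx₀ : G x₀) (hchain : Relation.ReflTransGen r x₀ x) :
    dist x₀ x ≤ M := by
  suffices hinv : ∃ K : Set X, IsContinuumSet K ∧ x₀ ∈ K ∧ x ∈ K ∧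
      (∀ z ∈ K, dist (f z) y₀ ≤ t) ∧ dist (f x) y₀ < t ∧ G x by
    obtain ⟨K, hK, hx₀K, hxK, hKB, -⟩ := hinv
    exact (Metric.dist_le_diam_of_mem hK.1.isBounded hx₀K hxK).trans (hconf K hK hx₀K hKB)
  induction hchain with
  | refl =>
    refine ⟨{x₀}, ⟨isCompact_singleton, isConnected_singleton⟩, rfl, rfl, ?_, hx₀, hGx₀⟩
    rintro z rfl
    exact hx₀.le
  | @tail x x' _ hstep ih =>
    obtain ⟨K, hK, hx₀K, hxK, hKB, hin, hGx⟩ := ih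
    have hxd : dist x₀ x ≤ M :=
      (Metric.dist_le_diam_of_mem hK.1.isBounded hx₀K hxK).trans (hconf K hK hx₀K hKB)
    obtain ⟨L, hL, hxL, hxL', hd⟩ := hjoin x x' hstep hxd
    have h1 := hsphere x hGx hxd
    rw [abs_of_neg (by linarith)] at h1
    have hLball : ∀ z ∈ L, dist (f z) y₀ < t := by
      intro z hz
      have h2 := Metric.dist_le_diam_of_mem (hL.1.image hf).isBounded
        (Set.mem_image_of_mem f hz) (Set.mem_image_of_mem f hxL)
      have h3 := dist_triangle (f z) (f x) y₀
      linarith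
    refine ⟨K ∪ L, hK.union hL hxK hxL, Or.inl hx₀K, Or.inr hxL', ?_, hLball x' hxL',
      hG x x' hstep hGx⟩
    rintro z (hz | hz)
    · exact hKB z hz
    · exact (hLball z hz).le

open Classical in
/-- If the Assouad exponent of the target is less than `n + 1`, the domain of a branched
quasisymmetry has coloured decompositions with `n + 1` colours. -/
theorem IsBranchedQuasisymmetry.exists_chainColoring {X : Type u} {Y : Type v} [MetricSpace X]
    [MetricSpace Y] [CompactSpace X] [Nontrivial X] (hX : IsBoundedTurning X) {f : X → Y}
    (hf : IsBranchedQuasisymmetry f) (hsurj : Function.Surjective f)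
    (hne : ∃ x x', f x ≠ f x') {β C : ℝ} {n : ℕ} (hY : AssouadBound Y C β) (hβ : β < n + 1) :
    ∃ c : ℝ, 0 < c ∧ ∀ s : ℝ, 0 < s → HasChainColoring X c s n := by
  have hconn := hX.connectedSpace
  obtain ⟨T₀, -, hT₀⟩ := hX
  set T := max T₀ 1 with hT
  have hT1 : 1 ≤ T := le_max_right _ _
  have hBT : ∀ x y : X, ∃ K : Set X, IsContinuumSet K ∧ x ∈ K ∧ y ∈ K ∧
      Metric.diam K ≤ T * dist x y := by
    intro x y
    obtain ⟨K, hK, hx, hy, hd⟩ := hT₀ x y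
    exact ⟨K, hK, hx, hy, hd.trans (by gcongr; exact le_max_left _ _)⟩
  obtain ⟨hfc, η, hη⟩ := hf
  have hYc : CompactSpace Y := ⟨by
    rw [← hsurj.range_eq]; exact isCompact_range hfc⟩
  obtain ⟨A, hA, hscale⟩ := IsBranchedQuasisymmetry.exists_image_scale hfc hη hne hT1 hBT
  have hmono : StrictMono η := NNReal.homeomorph_strictMono η
  -- `H₀`, `H₂` compare the image scales of points at distance at most `A * s`, respectively `s`.
  set H₀ : ℝ := 2 * η (T * A + T).toNNReal with hH₀
  set H₂ : ℝ := 2 * η (T * 1 + T).toNNReal with hH₂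
  have hH₀0 : 0 ≤ H₀ := by positivity
  have hH₂0 : 0 ≤ H₂ := by positivity
  set H : ℝ := max 1 ((H₀ * H₂) ^ 2) with hH
  obtain ⟨D, hD⟩ := hY.exists_neighbor_bound (le_max_left 1 ((H₀ * H₂) ^ 2))
  obtain ⟨κ, hκ0, hκ1, hradii⟩ := hY.exists_radii hβ (le_max_left 1 ((H₀ * H₂) ^ 2)) D
  set ζ : ℝ := κ / (2 * (n + 1)) with hζ
  have hζ0 : 0 < ζ := by positivity
  have hgapζ : κ / (n + 1) = 2 * ζ := by rw [hζ]; field_simp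
  obtain ⟨δ, hδ0, hδle, hδη⟩ := NNReal.homeomorph_exists_small η (T := T) (b := H₀ * H₂ + H₀)
    (δ₁ := ζ / κ) (by positivity) (by positivity) hζ0 (by positivity)
  have hδκ : κ * δ ≤ ζ := by rwa [mul_comm, ← le_div_iff₀ hκ0]
  -- The summand `2` takes care of scales comparable to the diameter of `X`.
  refine ⟨(A + 2) / δ, by positivity, fun s' hs' => ?_⟩
  -- The chain steps have length `s' = δ * s`.
  obtain ⟨s, rfl⟩ : ∃ s, s' = δ * s := ⟨s' / δ, by field_simp⟩
  have hs : 0 < s := pos_of_mul_pos_right hs' hδ0.le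
  have hcs : (A + 2) / δ * (δ * s) = (A + 2) * s := by field_simp
  rw [HasChainColoring, hcs]
  rcases le_or_gt (Metric.diam (Set.univ : Set X) / 2) s with hbig | hsd
  · refine ⟨fun _ => 0, fun x y _ => ?_⟩
    have h1 := Metric.dist_le_diam_of_mem (isCompact_univ (X := X)).isBounded
      (Set.mem_univ x) (Set.mem_univ y)
    nlinarith
  obtain ⟨r, ⟨m, M, hm, hmM⟩, hr1, hr2, hr3⟩ := hscale s hs hsd
  have hr0 : ∀ x, 0 < r x := fun x => hm.trans_le (hmM x).1
  choose j hj using fun x => exists_mem_Ico_zpow (hr0 x) (one_lt_two (α := ℝ))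
  have hj1 : ∀ x, (2 : ℝ) ^ j x ≤ r x := fun x => (hj x).1
  have hj2 : ∀ x, r x < 2 * 2 ^ j x := fun x => by
    have := (hj x).2
    rwa [zpow_add₀ two_ne_zero, zpow_one, mul_comm] at this
  have hfin : (Set.range j).Finite := by
    obtain ⟨x₀⟩ : Nonempty X := inferInstance
    obtain ⟨a, ha, -⟩ := exists_mem_Ico_zpow hm (one_lt_two (α := ℝ))
    obtain ⟨b, -, hb⟩ := exists_mem_Ico_zpow
      (hm.trans_le ((hmM x₀).1.trans (hmM x₀).2)) (one_lt_two (α := ℝ))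
    refine (Set.finite_Icc a b).subset ?_
    rintro _ ⟨x, rfl⟩
    have h1 := (zpow_lt_zpow_iff_right₀ (one_lt_two (α := ℝ))).1
      (ha.trans_lt ((hmM x).1.trans_lt (hj x).2))
    have h2 := (zpow_lt_zpow_iff_right₀ (one_lt_two (α := ℝ))).1
      ((hj1 x).trans_lt ((hmM x).2.trans_lt hb))
    exact ⟨by linarith, by linarith⟩
  choose N hNfin hNsep hNcov using fun b : ℤ =>
    exists_finite_separated_net Y (show (0 : ℝ) < 2 ^ b by positivity)
  let S : Set (ℤ × Y) := {q | q.1 ∈ Set.range j ∧ q.2 ∈ N q.1}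
  have hSfin : S.Finite := by
    refine ((hfin.prod (hfin.biUnion fun b _ => hNfin b))).subset fun q hq => ⟨hq.1, ?_⟩
    exact Set.mem_biUnion hq.1 hq.2
  have : Fintype S := hSfin.fintype
  let e : S → ℤ := fun i => i.1.1
  let y : S → Y := fun i => i.1.2
  obtain ⟨t, ht, hfew⟩ := hradii y (fun i => (2 : ℝ) ^ e i) (fun i => by positivity)
    (hD e y fun i i' hii he => by
      have h1 : i'.1.2 ∈ N i.1.1 := by
        have h3 : i.1.1 = i'.1.1 := he
        rw [h3]; exact i'.2.2
      refine hNsep _ _ i.2.2 _ h1 fun h2 => hii ?_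
      exact Subtype.ext (Prod.ext he h2))
  set P : ℤ → Set X := fun b => {x | (2 : ℝ) ^ j x ≤ H₀ * 2 ^ b ∧ (2 : ℝ) ^ b ≤ H₀ * 2 ^ j x}
    with hP
  have hcmpA : ∀ x x', dist x x' ≤ A * s → r x' ≤ H₀ * 2 ^ j x := by
    intro x x' h
    have h1 := hr3 A hA.le x x' h
    have h2 := hj2 x
    calc r x' ≤ η (T * A + T).toNNReal * r x := h1
      _ ≤ η (T * A + T).toNNReal * (2 * 2 ^ j x) := by gcongr
      _ = _ := by rw [hH₀]; ring
  have hcmp1 : ∀ x x', dist x x' ≤ s → r x' ≤ H₂ * 2 ^ j x := by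
    intro x x' h
    have h1 := hr3 1 zero_le_one x x' (by linarith)
    have h2 := hj2 x
    calc r x' ≤ η (T * 1 + T).toNNReal * r x := h1
      _ ≤ η (T * 1 + T).toNNReal * (2 * 2 ^ j x) := by gcongr
      _ = _ := by rw [hH₂]; ring
  have hPmem : ∀ x x', dist x x' ≤ A * s → x' ∈ P (j x) := fun x x' h =>
    ⟨(hj1 x').trans (hcmpA x x' h), (hj1 x).trans (hcmpA x' x (by rwa [dist_comm]))⟩
  have hPne : ∀ i : S, (P (e i)).Nonempty := by
    intro i
    obtain ⟨x, hx⟩ := i.2.1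
    refine ⟨x, ?_⟩
    have h1 := hPmem x x (by rw [dist_self]; positivity)
    rwa [hx] at h1
  -- Near `P b` the image scale is comparable to `2 ^ b`.
  have hPnear : ∀ i : S, ∀ x, Metric.infDist x (P (e i)) < s →
      r x ≤ H₀ * H₂ * 2 ^ e i ∧ (2 : ℝ) ^ e i ≤ H₀ * H₂ * 2 ^ j x := by
    intro i x hx
    obtain ⟨p, hp, hxp⟩ := (Metric.infDist_lt_iff (hPne i)).1 hx
    have h1 := hcmp1 p x (by rw [dist_comm]; exact hxp.le)
    have h2 := (hj1 p).trans (hcmp1 x p hxp.le)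
    constructor
    · calc r x ≤ H₂ * 2 ^ j p := h1
        _ ≤ H₂ * (H₀ * 2 ^ e i) := by gcongr; exact hp.1
        _ = _ := by ring
    · calc (2 : ℝ) ^ e i ≤ H₀ * 2 ^ j p := hp.2
        _ ≤ H₀ * (H₂ * 2 ^ j x) := by gcongr
        _ = _ := by ring
  set a : S → X → ℝ := fun i x =>
    min κ (max (|dist (f x) (y i) - t i| / 2 ^ e i) (κ * (Metric.infDist x (P (e i)) / s))) with ha
  -- The truncation at `κ` makes spheres of inappropriate scale irrelevant at `x`, and the distance
  -- to `P (e i)` makes this change slowly with `x`.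
  have hnear_of_lt : ∀ i x, a i x < κ → Metric.infDist x (P (e i)) < s ∧
      |dist (f x) (y i) - t i| < κ * 2 ^ e i := by
    intro i x h
    rcases min_lt_iff.1 h with h | h
    · exact absurd h (lt_irrefl _)
    obtain ⟨h1, h2⟩ := max_lt_iff.1 h
    constructor
    · have : Metric.infDist x (P (e i)) / s < 1 := by nlinarith
      rwa [div_lt_one hs] at this
    · rwa [div_lt_iff₀ (by positivity)] at h1
  have hcount : ∀ x, {i | 0 < a i x ∧ a i x < κ}.encard ≤ n := by
    intro x
    set σ : Finset S := Finset.univ.filter fun i => a i x < κ with hσ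
    have hsub : {i | 0 < a i x ∧ a i x < κ} ⊆ (σ : Set S) := fun i hi =>
      Finset.mem_coe.2 (Finset.mem_filter.2 ⟨Finset.mem_univ _, hi.2⟩)
    refine (Set.encard_le_encard hsub).trans ?_
    rw [Set.encard_coe_eq_coe_finsetCard]
    refine Nat.cast_le.2 (hfew σ (fun i hi i' hi' => ?_) (f x) fun i hi => ?_)
    · have h1 := hPnear i x (hnear_of_lt i x (Finset.mem_filter.1 hi).2).1
      have h2 := hPnear i' x (hnear_of_lt i' x (Finset.mem_filter.1 hi').2).1
      calc (2 : ℝ) ^ e i ≤ H₀ * H₂ * 2 ^ j x := h1.2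
        _ ≤ H₀ * H₂ * (H₀ * H₂ * 2 ^ e i') := by gcongr; exact (hj1 x).trans h2.1
        _ = (H₀ * H₂) ^ 2 * 2 ^ e i' := by ring
        _ ≤ H * 2 ^ e i' := by gcongr; exact le_max_right _ _
    · exact (hnear_of_lt i x (Finset.mem_filter.1 hi).2).2.le
  obtain ⟨col, hcol⟩ := exists_gap_coloring a hκ0 n hcount
  rw [hgapζ] at hcol
  have himage : ∀ x x', dist x x' ≤ δ * s → ∃ L, IsContinuumSet L ∧ x ∈ L ∧ x' ∈ L ∧
      Metric.diam (f '' L) ≤ η (T * δ).toNNReal * r x := by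
    intro x x' h
    obtain ⟨L, hL, hx, hx', hd⟩ := hBT x x'
    refine ⟨L, hL, hx, hx', hr1 (T * δ) (by positivity) L hL x hx (hd.trans ?_)⟩
    rw [mul_assoc]; gcongr
  have hvar' : ∀ i x x', dist x x' ≤ δ * s → Metric.infDist x (P (e i)) < s →
      |a i x - a i x'| ≤ ζ := by
    intro i x x' h hx
    refine (abs_min_sub_min_le_max _ _ _ _).trans ?_
    rw [sub_self, abs_zero]
    refine max_le hζ0.le ((abs_max_sub_max_le_max _ _ _ _).trans (max_le ?_ ?_))
    · have hpos : (0 : ℝ) < 2 ^ e i := by positivity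
      rw [← sub_div, abs_div, abs_of_pos hpos, div_le_iff₀ hpos]
      obtain ⟨L, hL, hxL, hxL', hd⟩ := himage x x' h
      have h1 : dist (f x) (f x') ≤ ζ * 2 ^ e i := by
        calc dist (f x) (f x') ≤ Metric.diam (f '' L) :=
              Metric.dist_le_diam_of_mem (hL.1.image hfc).isBounded ⟨x, hxL, rfl⟩ ⟨x', hxL', rfl⟩
          _ ≤ η (T * δ).toNNReal * r x := hd
          _ ≤ η (T * δ).toNNReal * (H₀ * H₂ * 2 ^ e i) := by gcongr; exact (hPnear i x hx).1
          _ = (η (T * δ).toNNReal * (H₀ * H₂)) * 2 ^ e i := by ring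
          _ ≤ (η (T * δ).toNNReal * (H₀ * H₂ + H₀)) * 2 ^ e i := by gcongr; linarith
          _ ≤ ζ * 2 ^ e i := by gcongr
      refine (abs_abs_sub_abs_le _ _).trans ?_
      rw [sub_sub_sub_cancel_right]
      exact (abs_dist_sub_le _ _ _).trans h1
    · rw [← mul_sub, ← sub_div, abs_mul, abs_div, abs_of_pos hκ0, abs_of_pos hs]
      have h1 : |Metric.infDist x (P (e i)) - Metric.infDist x' (P (e i))| ≤ δ * s := by
        have := (Metric.lipschitz_infDist_pt (P (e i))).dist_le_mul x x'
        rw [Real.dist_eq, NNReal.coe_one, one_mul] at this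
        exact this.trans h
      calc κ * (|Metric.infDist x (P (e i)) - Metric.infDist x' (P (e i))| / s) ≤
            κ * (δ * s / s) := by gcongr
        _ = κ * δ := by field_simp
        _ ≤ ζ := hδκ
  have hvar : ∀ i x x', dist x x' ≤ δ * s → |a i x - a i x'| ≤ ζ := by
    intro i x x' h
    rcases lt_or_ge (Metric.infDist x (P (e i))) s with hx | hx
    · exact hvar' i x x' h hx
    rcases lt_or_ge (Metric.infDist x' (P (e i))) s with hx' | hx'
    · rw [abs_sub_comm]
      exact hvar' i x' x (by rwa [dist_comm]) hx'
    have hfar : ∀ z, s ≤ Metric.infDist z (P (e i)) → a i z = κ := fun z hz =>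
      le_antisymm (min_le_left _ _)
        (le_of_not_gt fun hlt => absurd (hnear_of_lt i z hlt).1 hz.not_gt)
    rw [hfar x hx, hfar x' hx', sub_self, abs_zero]
    exact hζ0.le
  refine ⟨col, fun x₀ x hchain => ?_⟩
  obtain ⟨y₀, hy₀, hy₀d⟩ := hNcov (j x₀) (f x₀)
  set i₀ : S := ⟨(j x₀, y₀), ⟨x₀, rfl⟩, hy₀⟩ with hi₀
  set B : ℝ := 2 ^ j x₀ with hB
  have hB0 : 0 < B := by positivity
  have ht₀ : 2 * B ≤ t i₀ ∧ t i₀ ≤ 3 * B := ht i₀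
  have hbd : dist x₀ x ≤ A * s := by
    refine dist_le_of_chain_avoiding_sphere hfc (G := fun z => ¬ a i₀ z ≤ (col z : ℕ) * (2 * ζ))
      (y₀ := y₀) (t := t i₀) (mul_pos hζ0 hB0) (fun K hK hx₀K hKB => ?_) (fun z z' hzz hz => ?_)
      (fun z z' hzz hz hcon => ?_) (fun z hGz hz => ?_) (by linarith) ?_ hchain
    · refine hr2 K hK x₀ hx₀K (Metric.diam_le_of_forall_dist_le (by linarith [hr0 x₀]) ?_)
      rintro _ ⟨z, hz, rfl⟩ _ ⟨z', hz', rfl⟩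
      have := dist_triangle_right (f z) (f z') y₀
      linarith [hKB z hz, hKB z' hz', hj1 x₀]
    · obtain ⟨L, hL, hxL, hxL', hd⟩ := himage z z' hzz.2
      refine ⟨L, hL, hxL, hxL', ?_⟩
      calc Metric.diam (f '' L) ≤ η (T * δ).toNNReal * r z := hd
        _ ≤ η (T * δ).toNNReal * (H₀ * B) := by gcongr; exact hcmpA x₀ z hz
        _ = (η (T * δ).toNNReal * H₀) * B := by ring
        _ ≤ (η (T * δ).toNNReal * (H₀ * H₂ + H₀)) * B := by
            gcongr; linarith [mul_nonneg hH₀0 hH₂0]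
        _ ≤ ζ * B := by gcongr
    · refine hz (mem_of_gap hcol hzz.1.symm ?_ hcon)
      have := (abs_le.1 (hvar i₀ z z' hzz.2)).2
      linarith
    · have h2 := (hcol z i₀).resolve_left hGz
      have h3 : 2 * ζ ≤ a i₀ z := by
        refine le_trans ?_ h2
        have : (0 : ℝ) ≤ ((col z : ℕ) : ℝ) := by positivity
        nlinarith
      have h4 : 2 * ζ ≤ max (|dist (f z) y₀ - t i₀| / B)
          (κ * (Metric.infDist z (P (j x₀)) / s)) := h3.trans (min_le_right _ _)
      rw [Metric.infDist_zero_of_mem (hPmem x₀ z hz), zero_div, mul_zero] at h4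
      have h5 : 2 * ζ ≤ |dist (f z) y₀ - t i₀| / B := by
        rcases le_max_iff.1 h4 with h | h
        · exact h
        · linarith
      rw [le_div_iff₀ hB0] at h5
      linarith
    · have h1 : κ ≤ a i₀ x₀ := by
        refine le_min le_rfl (le_max_of_le_left ?_)
        change κ ≤ |dist (f x₀) y₀ - t i₀| / B
        rw [le_div_iff₀ hB0, abs_sub_comm]
        refine le_trans ?_ (le_abs_self _)
        nlinarith
      have h2 : ((col x₀ : ℕ) : ℝ) < n + 1 := by exact_mod_cast (col x₀).2
      have h3 : (n + 1) * (2 * ζ) = κ := by rw [← hgapζ]; field_simp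
      have h4 : ((col x₀ : ℕ) : ℝ) * (2 * ζ) < (n + 1) * (2 * ζ) := by gcongr
      linarith
  linarith

/-! ### The equality of dimensions -/

lemma nagataDim_le_of_hasChainColoring {X : Type u} [MetricSpace X] {c : ℝ} {n : ℕ} (hc : 0 < c)
    (h : ∀ s : ℝ, 0 < s → HasChainColoring X c s n) : nagataDim X ≤ n :=
  sInf_le ⟨n, rfl, c, hc, fun s hs => nagataCover_of_hasChainColoring (h s hs)⟩

lemma exists_hasChainColoring_of_nagataDim {X : Type u} [MetricSpace X] {n : ℕ}
    (h : nagataDim X = n) :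
    ∃ c : ℝ, 0 < c ∧ ∀ s : ℝ, 0 < s → HasChainColoring X c s n := by
  have hne : {N : ℕ∞ | ∃ n : ℕ, N = (n : ℕ∞) ∧
      ∃ c : ℝ, 0 < c ∧ ∀ s : ℝ, 0 < s → HasNagataCover X c s (n + 1)}.Nonempty := by
    by_contra hcon
    rw [nagataDim, Set.not_nonempty_iff_eq_empty.1 hcon, sInf_empty] at h
    exact ENat.natCast_ne_top n h.symm
  have hmem := csInf_mem hne
  rw [← nagataDim, h] at hmem
  obtain ⟨k, hk, c, hc, hcov⟩ := hmem
  obtain rfl : n = k := by exact_mod_cast hk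
  exact ⟨2 * (n + 2) * (1 + c), by positivity, hasChainColoring_of_nagataCover hc hcov⟩

/-- The Assouad dimension `a` of the image need not be an integer: the colouring with `⌊a⌋ + 1` colours
is applied to an exponent between `a` and `⌊a⌋ + 1`. -/
theorem nagataDim_le_assouadDim {X : Type u} {Y : Type v} [MetricSpace X] [MetricSpace Y]
    [CompactSpace X] [Nontrivial X] (hX : IsBoundedTurning X) {f : X → Y}
    (hf : IsBranchedQuasisymmetry f) (hsurj : Function.Surjective f)
    (hne : ∃ x x', f x ≠ f x') : ((nagataDim X : ℕ∞) : ℝ≥0∞) ≤ assouadDim Y := by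
  rcases eq_or_ne (assouadDim Y) ⊤ with htop | htop
  · rw [htop]; exact le_top
  lift assouadDim Y to ℝ≥0 using htop with a ha
  have hlt : assouadDim Y < ((⌊a⌋₊ + 1 : ℕ) : ℝ≥0∞) := by
    rw [← ha]; exact_mod_cast Nat.lt_floor_add_one a
  obtain ⟨b, ⟨β, -, rfl, C, -, hC⟩, hb⟩ := sInf_lt_iff.1 hlt
  have hβ : β < ⌊a⌋₊ + 1 := by
    rw [← ENNReal.ofReal_natCast] at hb
    have := (ENNReal.ofReal_lt_ofReal_iff (by positivity)).1 hb
    exact_mod_cast this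
  obtain ⟨c, hc, hcol⟩ := hf.exists_chainColoring hX hsurj hne hC hβ
  have h1 := nagataDim_le_of_hasChainColoring hc hcol
  calc ((nagataDim X : ℕ∞) : ℝ≥0∞) ≤ (((⌊a⌋₊ : ℕ) : ℕ∞) : ℝ≥0∞) := by exact_mod_cast h1
    _ = ((⌊a⌋₊ : ℕ) : ℝ≥0∞) := by simp
    _ ≤ a := by exact_mod_cast Nat.floor_le (zero_le (a := a))

/-- A space of Nagata dimension `n` has a branched quasisymmetric image in `ℝⁿ`. -/
theorem exists_branchedQuasisymmetry_of_nagataDim {X : Type u} [MetricSpace X] [CompactSpace X]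
    [Nontrivial X] (hX : IsBoundedTurning X) {n : ℕ} (h : nagataDim X = n) :
    ∃ (Y : Type v) (_ : MetricSpace Y) (f : X → Y), IsBranchedQuasisymmetry f ∧
      Function.Surjective f ∧ (∃ x x', f x ≠ f x') ∧ assouadDim Y ≤ n := by
  have hconn := hX.connectedSpace
  obtain ⟨c, hc, hcol⟩ := exists_hasChainColoring_of_nagataDim h
  obtain ⟨g, hg, α, A, a, hα, hA, ha, hdiam⟩ := exists_holder_map hc hcol
  let f : X → ULift.{v} (Set.range g) := fun x => ⟨⟨g x, x, rfl⟩⟩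
  have hiso : Isometry fun y : ULift.{v} (Set.range g) => (y.down : Fin n → ℝ) :=
    Isometry.of_dist_eq fun _ _ => rfl
  have hfd : ∀ E : Set X, Metric.diam (f '' E) = Metric.diam (g '' E) := by
    intro E
    rw [← hiso.diam_image, Set.image_image]
  have hfc : Continuous f := hiso.isEmbedding.continuous_iff.2 hg
  have hgne : ∃ x x', g x ≠ g x' := by
    by_contra! hcon
    have h1 := (hdiam Set.univ ⟨isCompact_univ, isConnected_univ⟩ Set.nontrivial_univ).1
    have h2 := diam_pos_of_nontrivial (isCompact_univ (X := X)) Set.nontrivial_univ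
    have h3 : Metric.diam (g '' Set.univ) = 0 := Metric.diam_subsingleton (by
      rintro _ ⟨x, -, rfl⟩ _ ⟨y, -, rfl⟩
      exact hcon x y)
    rw [h3] at h1
    have : 0 < a * Metric.diam (Set.univ : Set X) ^ α := by positivity
    linarith
  obtain ⟨x, x', hxx⟩ := hgne
  have hn : n ≠ 0 := by
    rintro rfl
    exact hxx (Subsingleton.elim _ _)
  refine ⟨ULift.{v} (Set.range g), inferInstance, f,
    isBranchedQuasisymmetry_of_holder hfc hα hA ha fun E hE hEn => ?_, ?_, ⟨x, x', fun hf => ?_⟩,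
    assouadDim_le_of_isometry hn hiso⟩
  · rw [hfd]; exact hdiam E hE hEn
  · rintro ⟨⟨_, x, rfl⟩⟩
    exact ⟨x, rfl⟩
  · exact hxx (congrArg (fun y : ULift.{v} (Set.range g) => (y.down : Fin n → ℝ)) hf)

theorem corollary1p11 (X : Type u) [MetricSpace X] [CompactSpace X] [Nontrivial X]
    (hX : IsBoundedTurning X) :
    ((nagataDim X : ℕ∞) : ℝ≥0∞) = sInf (branchedImageAssouadDims.{u, v} X) ∧
      (nagataDim X ≠ ⊤ →
        sInf (branchedImageAssouadDims.{u, v} X) ∈ branchedImageAssouadDims.{u, v} X) := by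
  have hle : ((nagataDim X : ℕ∞) : ℝ≥0∞) ≤ sInf (branchedImageAssouadDims.{u, v} X) := by
    refine le_sInf ?_
    rintro _ ⟨Y, _, f, hf, hsurj, hne, rfl⟩
    exact nagataDim_le_assouadDim hX hf hsurj hne
  rcases eq_or_ne (nagataDim X) ⊤ with htop | htop
  · refine ⟨le_antisymm hle ?_, fun h => absurd htop h⟩
    rw [htop, ENat.toENNReal_top]
    exact le_top
  · obtain ⟨n, hn⟩ := ENat.ne_top_iff_exists.1 htop
    obtain ⟨Y, _, f, hf, hsurj, hne, hdim⟩ :=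
      exists_branchedQuasisymmetry_of_nagataDim.{u, v} hX hn.symm
    have hY : assouadDim Y = ((nagataDim X : ℕ∞) : ℝ≥0∞) := by
      refine le_antisymm ?_ (nagataDim_le_assouadDim hX hf hsurj hne)
      rw [← hn, ENat.toENNReal_coe]
      exact hdim
    have hmem : assouadDim Y ∈ branchedImageAssouadDims.{u, v} X :=
      ⟨Y, _, f, hf, hsurj, hne, rfl⟩
    have heq : ((nagataDim X : ℕ∞) : ℝ≥0∞) = sInf (branchedImageAssouadDims.{u, v} X) :=
      le_antisymm hle (hY ▸ sInf_le hmem)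
    exact ⟨heq, fun _ => by rw [← heq, ← hY]; exact hmem⟩
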